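/- **Setting.** Let $g\ge 1$. Fix vectors $(a_1,b_1),(a_2,b_2)\in\mathbb C^2\setminus\{0\}$ with $[a_1,b_1]\neq[a_2,b_2]$ in $\mathbb CP^1$, an invertible linear map $\mathcal P:\mathbb C^g\to\mathbb C^g$ with pairwise distinct eigenvalues and eigenvectors $v_1,\dots,v_g$, and constants $A,\Lambda,\tilde c_1,\dots,\tilde c_g\in\mathbb C^*$. Let $\Gamma$ be the rational variety obtained from $\mathbb CP^1\times\mathbb CP^{g-1}$ by identifying $([a_1,b_1],t)$ with $([a_2,b_2],\mathcal P(t))$ for all $t\in\mathbb CP^{g-1}$. Let $F_i(z_1,z_2,t,s)=\sum_{k=1}^g(\gamma_{ik}(s)z_1+\delta_{ik}(s)z_2)t_k$, $i=1,\dots,g$, $s\in\mathbb C$, be functions whose coefficients are holomorphic near $s=0$, such that $$F_i(a_1,b_1,t,s)=Ae^{s}F_i(a_2,b_2,\mathcal P(t),s)\quad\text{for all }t\in\mathbb C^g,\ s\in\mathbb C,$$ $f(z_1,z_2,t):=F_i(z_1,z_2,t,0)$ does not depend on $i$, $f(a_1,b_1,v_j)\ne0$ for all $j$, and $f,\partial_sF_1|_{s=0},\dots,\partial_sF_g|_{s=0}$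 are linearly independent. For $h=(h_1,\dots,h_g)\in(\mathbb C^*)^g$ put $f_i(z_1,z_2,t)=F_i(z_1,z_2,t,\tilde c_ih_i)$, so that $f_i(a_1,b_1,t)=c_i f_i(a_2,b_2,\mathcal P(t))$ with $c_i=Ae^{\tilde c_ih_i}$. Let $\mathcal K$ be the field of rational functions of $e^{\tilde c_1x_1+\dots+\tilde c_gx_g}$, $x\in\mathbb C^g$, and for $r\in\mathcal K$ let $\hat r$ be the map $\mathbb Z^g\to\mathcal K$, $\hat r(n)=r(x+nh)$, where $nh=(n_1h_1,\dots,n_gh_g)$. Let $\hat{\mathcal K}=\{\hat r: r\in\mathcal K\}$, let $T_i$ be the shift $n\mapsto n+e_i$ of functions of $n\in\mathbb Z^g$, and let $\mathcal T_g=\hat{\mathcal K}[T_1,\dots,T_g]$ be the ring of difference operators. When no $f_i$ vanishes identically, let $\hat M_\Lambda(k)$, $k\ge0$, be the set of functions of $n\in\mathbb Z^g$ and $P=(z_1,z_2,t)$ $$\psi(n,P)=\frac{h(n,P)}{f(P)^k}\prod_{j=1}^g\Big(\frac{f_j(P)}{f(P)}\Big)^{n_j},\qquad h(n,P)=\sum_{0\le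 j\le k,\ |\alpha|=k}h_{j\alpha}(n)\,z_1^jz_2^{k-j}t^\alpha,\quad h_{j\alpha}\in\hat{\mathcal K},$$ such that $$\psi(n,a_1,b_1,t)=\Lambda e^{-(\tilde c_1x_1+\dots+\tilde c_gx_g)}\,\psi(n,a_2,b_2,\mathcal P(t)).$$ Then $\hat M_\Lambda=\bigcup_{k\ge0}\hat M_\Lambda(k)$ (the discrete Baker--Akhiezer module of $\Gamma$) is a $\mathcal T_g$-module. **Theorem 2.** For uncountably many $h\in(\mathbb C^*)^g$ no $f_i$ vanishes identically and $\hat M_\Lambda$ is a free $\mathcal T_g$-module of rank $g$, with a basis consisting of $g$ functions from $\hat M_\Lambda(1)$. -/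

import Mathlib

open scoped Matrix

noncomputable section

namespace DBA

/-! ### Coefficient functions -/

/-- The field `𝒦` of rational functions of `w = exp (c₁ x₁ + ⋯ + c_g x_g)` (all `c_i ≠ 0`), as
rational functions of the letter `w`. -/
abbrev K : Type := RatFunc ℂ

/-- The function `w = exp (c₁ x₁ + ⋯ + c_g x_g)` itself. -/
def w : K := RatFunc.X

theorem comp_mem (s : ℂ) : nonZeroDivisors (Polynomial ℂ) ≤
    (nonZeroDivisors (Polynomial ℂ)).comap
      (Polynomial.compRingHom (Polynomial.C (Complex.exp s) * Polynomial.X)) := by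
  intro p hp
  rw [Submonoid.mem_comap, mem_nonZeroDivisors_iff_ne_zero]
  rw [mem_nonZeroDivisors_iff_ne_zero] at hp
  intro h
  apply hp
  rwa [Polynomial.coe_compRingHom_apply, Polynomial.comp_C_mul_X_eq_zero_iff] at h
  exact mem_nonZeroDivisors_of_ne_zero (Complex.exp_ne_zero s)

/-- If `x` is translated by a vector `y`, then `w` is replaced by `exp s * w`, where
`s = c₁ y₁ + ⋯ + c_g y_g`. This is the effect on a rational function of `w`. -/
def translate (s : ℂ) : K →+* K :=
  RatFunc.mapRingHom (Polynomial.compRingHom (Polynomial.C (Complex.exp s) * Polynomial.X))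
    (comp_mem s)

theorem translate_algebraMap (s : ℂ) (p : Polynomial ℂ) :
    translate s (algebraMap _ K p) =
      algebraMap _ K (p.comp (Polynomial.C (Complex.exp s) * Polynomial.X)) := by
  have h := RatFunc.map_apply_div
    (Polynomial.compRingHom (Polynomial.C (Complex.exp s) * Polynomial.X)) (comp_mem s) p 1
  simpa [translate, RatFunc.coe_mapRingHom_eq_coe_map] using h

theorem translate_w (s : ℂ) : translate s w = algebraMap ℂ K (Complex.exp s) * w := by
  have h := translate_algebraMap s Polynomial.X
  rw [RatFunc.algebraMap_X] at h
  rw [w, h, Polynomial.X_comp, map_mul, RatFunc.algebraMap_X, RatFunc.algebraMap_C]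
  rfl

theorem translate_const (s : ℂ) (a : ℂ) : translate s (algebraMap ℂ K a) = algebraMap ℂ K a := by
  have h := translate_algebraMap s (Polynomial.C a)
  rwa [Polynomial.C_comp, RatFunc.algebraMap_C] at h

theorem translate_translate (s u : ℂ) (r : K) :
    translate s (translate u r) = translate (s + u) r := by
  induction r using RatFunc.induction_on with
  | f p q hq =>
    simp only [map_div₀, translate_algebraMap, Polynomial.comp_assoc, Polynomial.mul_comp,
      Polynomial.C_comp, Polynomial.X_comp, Complex.exp_add, Polynomial.C_mul]
    rw [← mul_assoc, mul_comm (Polynomial.C (Complex.exp u))]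

/-! ### Points of `ℂ^(g+2)` over an extension ring, and bilinear functions -/

variable {g : ℕ}

/-- The function `∑ k, (c 0 k * z₁ + c 1 k * z₂) * t k` of `(z₁, z₂, t₁, …, t_g)`, at a point
with coordinates in a `ℂ`-algebra `R`. -/
def bilin {R : Type*} [CommRing R] [Algebra ℂ R] (c : Fin 2 → Fin g → ℂ)
    (z : Fin 2 → R) (t : Fin g → R) : R :=
  ∑ k, (algebraMap ℂ R (c 0 k) * z 0 + algebraMap ℂ R (c 1 k) * z 1) * t k

variable (g) in
/-- The polynomial ring `𝒦[z₁, z₂, t₁, …, t_g]`; `Sum.inl` indexes `z₁, z₂` and `Sum.inr` indexes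
`t₁, …, t_g`. -/
abbrev Poly : Type := MvPolynomial (Fin 2 ⊕ Fin g) K

variable (g) in
/-- The field `𝒦(z₁, z₂, t₁, …, t_g)`. -/
abbrev L : Type := FractionRing (Poly g)

/-- The coordinates `z₁, z₂` of the generic point `P`. -/
def zGen : Fin 2 → L g := fun e => algebraMap (Poly g) (L g) (MvPolynomial.X (Sum.inl e))

/-- The coordinates `t₁, …, t_g` of the generic point `P`. -/
def tGen : Fin g → L g := fun k => algebraMap (Poly g) (L g) (MvPolynomial.X (Sum.inr k))

/-- A constant vector, as a vector over the function field. -/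
def const {ι : Type*} (p : ι → ℂ) : ι → L g := fun e => algebraMap ℂ (L g) (p e)

/-- Bidegree: `z₁, z₂` have bidegree `(1, 0)` and `t₁, …, t_g` have bidegree `(0, 1)`. -/
def bideg : Fin 2 ⊕ Fin g → ℕ × ℕ := Sum.elim (fun _ => (1, 0)) (fun _ => (0, 1))

/-! ### The data -/

variable (g) in
/-- The data from which the rational variety and the module over it are built. -/
structure Data where
  /-- the point `(a₁, b₁)` -/
  p₁ : Fin 2 → ℂ
  /-- the point `(a₂, b₂)` -/
  p₂ : Fin 2 → ℂ
  /-- both are non-zero and `[a₁, b₁] ≠ [a₂, b₂]` in `ℂP¹` -/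
  indep : LinearIndependent ℂ ![p₁, p₂]
  /-- the linear map gluing `{[a₁, b₁]} × ℂP^(g-1)` to `{[a₂, b₂]} × ℂP^(g-1)` -/
  P : Matrix (Fin g) (Fin g) ℂ
  P_nondeg : IsUnit P.det
  /-- the eigenvalues of `P` -/
  ev : Fin g → ℂ
  ev_injective : Function.Injective ev
  /-- the eigenvectors of `P` -/
  v : Fin g → Fin g → ℂ
  v_ne_zero : ∀ j, v j ≠ 0
  v_eigen : ∀ j, P *ᵥ v j = ev j • v j
  A : ℂ
  A_ne_zero : A ≠ 0
  /-- coefficients of `f(z, t)` -/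
  f : Fin 2 → Fin g → ℂ
  f_eigen : ∀ j, bilin f p₁ (v j) ≠ 0
  f_glue : ∀ t : Fin g → ℂ, bilin f p₁ t = A * bilin f p₂ (P *ᵥ t)
  /-- coefficients of `F_i(z, t, s)` -/
  F : Fin g → ℂ → Fin 2 → Fin g → ℂ
  F_analytic : ∀ i, AnalyticAt ℂ (F i) 0
  F_glue : ∀ i s, ∀ t : Fin g → ℂ,
    bilin (F i s) p₁ t = A * Complex.exp s * bilin (F i s) p₂ (P *ᵥ t)
  F_zero : ∀ i, F i 0 = f
  /-- `f, ∂_s F_1(z, t, 0), …, ∂_s F_g(z, t, 0)` are linearly independent -/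
  F_indep : LinearIndependent ℂ (Fin.cons f (fun i => deriv (F i) 0) :
    Fin (g + 1) → Fin 2 → Fin g → ℂ)
  /-- the exponents `c_i` in `w = exp (c₁ x₁ + ⋯ + c_g x_g)` -/
  c : Fin g → ℂ
  c_ne_zero : ∀ i, c i ≠ 0
  Λ : ℂ
  Λ_ne_zero : Λ ≠ 0

namespace Data

variable (D : Data g) (h : Fin g → ℂ)

/-- Coefficients of `f_i(z, t) = F_i(z, t, c_i h_i)`; it satisfies
`f_i(a₁, b₁, t) = A exp(c_i h_i) f_i(a₂, b₂, P t)`. -/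
def fi (i : Fin g) : Fin 2 → Fin g → ℂ := D.F i (D.c i * h i)

/-- The step vector `h` has non-zero entries, and no `f_i` is identically zero (so that integral
powers of `f_i / f` make sense). -/
structure Admissible : Prop where
  h_ne_zero : ∀ i, h i ≠ 0
  fi_ne_zero : ∀ i, D.fi h i ≠ 0

/-- The translation `r(x) ↦ r(x + n h)`, with `n h = (n₁ h₁, …, n_g h_g)`. -/
def shift (n : Fin g → ℤ) : K →+* K := translate (∑ i, D.c i * (n i * h i))

/-- The element `r̂ : n ↦ r(x + n h)` of the ring `𝒦̂` of discrete functions. -/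
def hat (r : K) : (Fin g → ℤ) → K := fun n => D.shift h n r

/-- For a polynomial `H` in `z, t` with coefficients in `𝒦`, the value at the point `(z, t)` of the
polynomial `h(n, ·)` whose coefficients are the discrete functions `r̂(n)`, for `r` the coefficients
of `H`. -/
def numer (H : Poly g) (n : Fin g → ℤ) (z : Fin 2 → L g) (t : Fin g → L g) : L g :=
  MvPolynomial.eval₂ ((algebraMap K (L g)).comp (D.shift h n)) (Sum.elim z t) H

/-- `ψ(n, z, t) = h(n, z, t) / f(z, t)^k * ∏ j, (f_j(z, t) / f(z, t))^(n_j)`. -/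
def psi (k : ℕ) (H : Poly g) (n : Fin g → ℤ) (z : Fin 2 → L g) (t : Fin g → L g) : L g :=
  D.numer h H n z t / bilin D.f z t ^ k * ∏ j, (bilin (D.fi h j) z t / bilin D.f z t) ^ n j

/-- The image `P(t)` of the point `t`. -/
def glue (t : Fin g → L g) : Fin g → L g := D.P.map (algebraMap ℂ (L g)) *ᵥ t

/-- `ψ(n, a₁, b₁, t) = Λ exp(-(c₁ x₁ + ⋯ + c_g x_g)) ψ(n, a₂, b₂, P(t))` for all `n` and `t`. -/
def Glued (k : ℕ) (H : Poly g) : Prop :=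
  ∀ n, D.psi h k H n (const D.p₁) tGen =
    algebraMap K (L g) (algebraMap ℂ K D.Λ * w⁻¹) * D.psi h k H n (const D.p₂) (D.glue tGen)

/-- The set `M̂_Λ(k)`. -/
def level (k : ℕ) : Set ((Fin g → ℤ) → L g) :=
  {ψ | ∃ H : Poly g, MvPolynomial.IsWeightedHomogeneous bideg H (k, k) ∧ D.Glued h k H ∧
    ∀ n, ψ n = D.psi h k H n zGen tGen}

/-- Multiplication of functions on `ℤ^g` by the discrete function `r̂`. -/
def mulOp (r : K) : Module.End ℂ ((Fin g → ℤ) → L g) where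
  toFun ψ := fun n => algebraMap K (L g) (D.hat h r n) * ψ n
  map_add' ψ φ := by funext n; simp [mul_add]
  map_smul' a ψ := by funext n; simp

variable (g) in
/-- The shift operator `T_i`, `(T_i ψ)(n) = ψ(n + e_i)`. -/
def shiftOp (i : Fin g) : Module.End ℂ ((Fin g → ℤ) → L g) where
  toFun ψ := fun n => ψ (n + Pi.single i 1)
  map_add' _ _ := rfl
  map_smul' _ _ := rfl

/-- The ring `𝒯_g = 𝒦̂[T_1, …, T_g]` of difference operators: the ring of operators generated by
multiplications by elements of `𝒦̂` and by `T_1, …, T_g`. -/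
def opRing : Subring (Module.End ℂ ((Fin g → ℤ) → L g)) :=
  Subring.closure (Set.range (D.mulOp h) ∪ Set.range (shiftOp g))

/-! ### `⋃ k, M̂_Λ(k)` is a `𝒯_g`-submodule -/

section aux

/-- The bilinear function as a polynomial. -/
def bilinPoly (c : Fin 2 → Fin g → ℂ) : Poly g :=
  bilin c (fun e => MvPolynomial.X (Sum.inl e)) (fun k => MvPolynomial.X (Sum.inr k))

theorem bilinPoly_hom (c : Fin 2 → Fin g → ℂ) :
    MvPolynomial.IsWeightedHomogeneous bideg (bilinPoly c) (1, 1) := by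
  refine MvPolynomial.IsWeightedHomogeneous.sum _ _ _ fun k _ => ?_
  have hz (e : Fin 2) : MvPolynomial.IsWeightedHomogeneous (bideg (g := g))
      (algebraMap ℂ (Poly g) (c e k) * MvPolynomial.X (Sum.inl e)) (1, 0) := by
    have h := (MvPolynomial.isWeightedHomogeneous_C (bideg (g := g)) (algebraMap ℂ K (c e k))).mul
      (MvPolynomial.isWeightedHomogeneous_X K (bideg (g := g)) (Sum.inl e))
    simpa [bideg, MvPolynomial.algebraMap_apply] using h
  have := ((hz 0).add (hz 1)).mul
    (MvPolynomial.isWeightedHomogeneous_X K (bideg (g := g)) (Sum.inr k))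
  simpa [bideg] using this

theorem numer_bilinPoly (c : Fin 2 → Fin g → ℂ) (n : Fin g → ℤ) (z : Fin 2 → L g)
    (t : Fin g → L g) : D.numer h (bilinPoly c) n z t = bilin c z t := by
  have (a : ℂ) : algebraMap K (L g) (D.shift h n (algebraMap ℂ K a)) = algebraMap ℂ (L g) a := by
    rw [shift, translate_const, ← IsScalarTower.algebraMap_apply]
  simp only [RatFunc.algebraMap_eq_C] at this
  simp [numer, bilinPoly, bilin, MvPolynomial.eval₂_sum, MvPolynomial.eval₂_mul,
    MvPolynomial.eval₂_add, MvPolynomial.algebraMap_apply, this]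

theorem numer_mul (H G : Poly g) (n : Fin g → ℤ) (z : Fin 2 → L g) (t : Fin g → L g) :
    D.numer h (H * G) n z t = D.numer h H n z t * D.numer h G n z t :=
  MvPolynomial.eval₂_mul _ _

theorem numer_map (H : Poly g) (m n : Fin g → ℤ) (z : Fin 2 → L g) (t : Fin g → L g) :
    D.numer h (H.map (D.shift h m)) n z t = D.numer h H (n + m) z t := by
  rw [numer, numer, MvPolynomial.eval₂_map]
  congr 1
  ext r
  simp only [RingHom.comp_apply, shift, translate_translate]
  congr 3
  rw [← Finset.sum_add_distrib]
  refine Finset.sum_congr rfl fun i _ => ?_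
  simp only [Pi.add_apply]
  push_cast
  ring

theorem bilin_gen_ne_zero {c : Fin 2 → Fin g → ℂ} (hc : c ≠ 0) :
    bilin c (zGen (g := g)) tGen ≠ 0 := by
  have h1 : bilin c (zGen (g := g)) tGen = algebraMap (Poly g) (L g) (bilinPoly c) := by
    simp only [bilin, bilinPoly, zGen, tGen, map_sum, map_mul, map_add,
      ← IsScalarTower.algebraMap_apply]
  rw [h1, Ne, FaithfulSMul.algebraMap_eq_zero_iff]
  intro h0
  apply hc
  funext e k
  have h2 := congrArg (MvPolynomial.eval
    (Sum.elim (Pi.single e 1) (Pi.single k 1) : Fin 2 ⊕ Fin g → K)) h0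
  fin_cases e <;>
  · simp [bilinPoly, bilin, MvPolynomial.algebraMap_apply, Pi.single_apply] at h2
    simpa using h2

theorem bilin_const {c : Fin 2 → Fin g → ℂ} {p : Fin 2 → ℂ} (t : Fin g → L g) :
    bilin c (const p) t =
      ∑ k, algebraMap ℂ (L g) (bilin c p (Pi.single k 1)) * t k := by
  refine Finset.sum_congr rfl fun k _ => ?_
  simp [bilin, const, Pi.single_apply]

theorem bilin_const_glue {c : Fin 2 → Fin g → ℂ} {κ : ℂ}
    (hg : ∀ t : Fin g → ℂ, bilin c D.p₁ t = κ * bilin c D.p₂ (D.P *ᵥ t)) (t : Fin g → L g) :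
    bilin c (const D.p₁) t = algebraMap ℂ (L g) κ * bilin c (const D.p₂) (D.glue t) := by
  rw [bilin_const]
  have key (k : Fin g) : algebraMap ℂ (L g) (bilin c D.p₁ (Pi.single k 1)) =
      algebraMap ℂ (L g) κ * ∑ i, (algebraMap ℂ (L g) (c 0 i) * algebraMap ℂ (L g) (D.p₂ 0) +
        algebraMap ℂ (L g) (c 1 i) * algebraMap ℂ (L g) (D.p₂ 1)) *
          algebraMap ℂ (L g) (D.P i k) := by
    rw [hg]
    simp [bilin]
  simp only [key]
  simp only [bilin, glue, Matrix.mulVec, dotProduct, const, Finset.mul_sum,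
    Finset.sum_mul, Matrix.map_apply]
  rw [Finset.sum_comm]
  refine Finset.sum_congr rfl fun i _ => Finset.sum_congr rfl fun j _ => ?_
  ring

theorem bilin_p_ne_zero {c : Fin 2 → Fin g → ℂ} (hc : c ≠ 0) {κ : ℂ} (hκ : κ ≠ 0)
    (hg : ∀ t : Fin g → ℂ, bilin c D.p₁ t = κ * bilin c D.p₂ (D.P *ᵥ t)) :
    bilin c (const (g := g) D.p₁) tGen ≠ 0 ∧
      bilin c (const (g := g) D.p₂) (D.glue tGen) ≠ 0 := by
  have h1 : bilin c (const (g := g) D.p₁) tGen ≠ 0 := by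
    intro h0
    -- the linear form `bilin c p₁ ·` vanishes
    have hu : ∀ k, bilin c D.p₁ (Pi.single k 1) = 0 := by
      intro k
      rw [bilin_const] at h0
      have h2 : (algebraMap (Poly g) (L g)) (∑ k, MvPolynomial.C
          (algebraMap ℂ K (bilin c D.p₁ (Pi.single k 1))) * MvPolynomial.X (Sum.inr k)) = 0 := by
        rw [← h0, map_sum]
        refine Finset.sum_congr rfl fun i _ => ?_
        rw [map_mul, tGen, ← MvPolynomial.algebraMap_eq, ← IsScalarTower.algebraMap_apply,
          ← IsScalarTower.algebraMap_apply]
      rw [FaithfulSMul.algebraMap_eq_zero_iff] at h2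
      have h3 := congrArg (MvPolynomial.eval
        (Sum.elim 0 (Pi.single k 1) : Fin 2 ⊕ Fin g → K)) h2
      simpa [Pi.single_apply] using h3
    have lin (p : Fin 2 → ℂ) (t : Fin g → ℂ) :
        bilin c p t = ∑ k, bilin c p (Pi.single k 1) * t k := by
      refine Finset.sum_congr rfl fun k _ => ?_
      simp [bilin, Pi.single_apply]
    have hu' : ∀ t, bilin c D.p₁ t = 0 := fun t => by rw [lin]; simp [hu]
    have hv' : ∀ t, bilin c D.p₂ t = 0 := by
      intro t
      have h4 := hg (D.P⁻¹ *ᵥ t)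
      rw [hu', Matrix.mulVec_mulVec, Matrix.mul_nonsing_inv _ D.P_nondeg, Matrix.one_mulVec] at h4
      exact (mul_eq_zero.mp h4.symm).resolve_left hκ
    have hM : IsUnit (Matrix.of ![D.p₁, D.p₂]) :=
      Matrix.linearIndependent_rows_iff_isUnit.mp D.indep
    apply hc
    funext e k
    have h5 : Matrix.of ![D.p₁, D.p₂] *ᵥ (fun e => c e k) = 0 := by
      funext i
      have h6 := hu' (Pi.single k 1)
      have h7 := hv' (Pi.single k 1)
      simp only [bilin, Pi.single_apply, mul_ite, mul_one, mul_zero, Finset.sum_ite_eq',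
        Finset.mem_univ, if_true, Algebra.algebraMap_self, RingHom.id_apply] at h6 h7
      fin_cases i
      · simpa [Matrix.mulVec, dotProduct, Fin.sum_univ_two, mul_comm] using h6
      · simpa [Matrix.mulVec, dotProduct, Fin.sum_univ_two, mul_comm] using h7
    have h8 := Matrix.mulVec_injective_of_isUnit hM (h5.trans (Matrix.mulVec_zero _).symm)
    exact congrFun h8 e
  refine ⟨h1, fun h2 => h1 ?_⟩
  rw [D.bilin_const_glue hg, h2, mul_zero]

theorem fi_glue (i : Fin g) (t : Fin g → ℂ) : bilin (D.fi h i) D.p₁ t =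
    D.A * Complex.exp (D.c i * h i) * bilin (D.fi h i) D.p₂ (D.P *ᵥ t) :=
  D.F_glue i _ t

theorem f_ne_zero : D.f ≠ 0 := D.F_indep.ne_zero 0

variable {D h}

theorem ratio_ne_zero (hh : D.Admissible h) (i : Fin g) :
    bilin (D.fi h i) zGen tGen / bilin D.f (zGen (g := g)) tGen ≠ 0 ∧
    bilin (D.fi h i) (const D.p₁) tGen / bilin D.f (const (g := g) D.p₁) tGen ≠ 0 ∧
    bilin (D.fi h i) (const D.p₂) (D.glue tGen) /
      bilin D.f (const (g := g) D.p₂) (D.glue tGen) ≠ 0 := by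
  have h1 := D.bilin_p_ne_zero (hh.fi_ne_zero i)
    (mul_ne_zero D.A_ne_zero (Complex.exp_ne_zero (D.c i * h i))) (D.fi_glue h i)
  have h2 := D.bilin_p_ne_zero D.f_ne_zero D.A_ne_zero D.f_glue
  exact ⟨div_ne_zero (bilin_gen_ne_zero (hh.fi_ne_zero i)) (bilin_gen_ne_zero D.f_ne_zero),
    div_ne_zero h1.1 h2.1, div_ne_zero h1.2 h2.2⟩

theorem psi_shift (k : ℕ) (H : Poly g) (i : Fin g) (n : Fin g → ℤ) (z : Fin 2 → L g)
    (t : Fin g → L g) (hr : bilin (D.fi h i) z t / bilin D.f z t ≠ 0) :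
    D.psi h (k + 1) (H.map (D.shift h (Pi.single i 1)) * bilinPoly (D.fi h i)) n z t =
      D.psi h k H (n + Pi.single i 1) z t := by
  have h1 : ∏ j, (bilin (D.fi h j) z t / bilin D.f z t) ^ (n + Pi.single i 1 : Fin g → ℤ) j =
      (∏ j, (bilin (D.fi h j) z t / bilin D.f z t) ^ n j) *
        (bilin (D.fi h i) z t / bilin D.f z t) := by
    rw [← Finset.mul_prod_erase _ _ (Finset.mem_univ i),
      ← Finset.mul_prod_erase Finset.univ
        (fun j => (bilin (D.fi h j) z t / bilin D.f z t) ^ n j) (Finset.mem_univ i)]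
    have h2 : ∀ j ∈ Finset.univ.erase i,
        (bilin (D.fi h j) z t / bilin D.f z t) ^ (n + Pi.single i 1 : Fin g → ℤ) j =
        (bilin (D.fi h j) z t / bilin D.f z t) ^ n j := by
      intro j hj
      rw [Pi.add_apply, Pi.single_eq_of_ne (Finset.ne_of_mem_erase hj), add_zero]
    rw [Finset.prod_congr rfl h2, Pi.add_apply, Pi.single_eq_same, zpow_add_one₀ hr]
    ring
  rw [psi, psi, h1, numer_mul, numer_map, numer_bilinPoly, pow_succ]
  have h3 : bilin D.f z t ≠ 0 := fun h0 => hr (by rw [h0, div_zero])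
  field_simp

theorem psi_up (k : ℕ) (H : Poly g) (n : Fin g → ℤ) (z : Fin 2 → L g)
    (t : Fin g → L g) (hf : bilin D.f z t ≠ 0) :
    D.psi h (k + 1) (H * bilinPoly D.f) n z t = D.psi h k H n z t := by
  rw [psi, psi, numer_mul, numer_bilinPoly, pow_succ, mul_div_mul_right _ _ hf]

theorem psi_add (k : ℕ) (H G : Poly g) (n : Fin g → ℤ) (z : Fin 2 → L g) (t : Fin g → L g) :
    D.psi h k (H + G) n z t = D.psi h k H n z t + D.psi h k G n z t := by
  rw [psi, numer, MvPolynomial.eval₂_add, add_div, add_mul]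
  rfl

theorem psi_C_mul (k : ℕ) (r : K) (H : Poly g) (n : Fin g → ℤ) (z : Fin 2 → L g)
    (t : Fin g → L g) : D.psi h k (MvPolynomial.C r * H) n z t =
      algebraMap K (L g) (D.hat h r n) * D.psi h k H n z t := by
  rw [psi, numer_mul, numer, MvPolynomial.eval₂_C, mul_div_assoc, mul_assoc]
  rfl

theorem level_succ (k : ℕ) : D.level h k ⊆ D.level h (k + 1) := by
  rintro ψ ⟨H, hH, hG, hψ⟩
  have h2 := D.bilin_p_ne_zero D.f_ne_zero D.A_ne_zero D.f_glue
  refine ⟨H * bilinPoly D.f, hH.mul (bilinPoly_hom _), fun n => ?_, fun n => ?_⟩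
  · rw [psi_up _ _ _ _ _ h2.1, psi_up _ _ _ _ _ h2.2, hG]
  · rw [psi_up _ _ _ _ _ (bilin_gen_ne_zero D.f_ne_zero), hψ]

theorem level_mono : Monotone (D.level h) := monotone_nat_of_le_succ level_succ

theorem level_add {k : ℕ} {ψ φ : (Fin g → ℤ) → L g} (hψ : ψ ∈ D.level h k)
    (hφ : φ ∈ D.level h k) : ψ + φ ∈ D.level h k := by
  obtain ⟨H, hH, hG, hψ⟩ := hψ
  obtain ⟨H', hH', hG', hφ⟩ := hφ
  refine ⟨H + H', hH.add hH', fun n => ?_, fun n => ?_⟩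
  · rw [psi_add, psi_add, hG, hG', mul_add]
  · rw [psi_add, Pi.add_apply, hψ, hφ]

theorem level_zero_mem (k : ℕ) : (0 : (Fin g → ℤ) → L g) ∈ D.level h k := by
  refine ⟨0, MvPolynomial.isWeightedHomogeneous_zero _ _ _, fun n => ?_, fun n => ?_⟩ <;>
  simp [psi, numer]

theorem level_mulOp {k : ℕ} (r : K) {ψ : (Fin g → ℤ) → L g} (hψ : ψ ∈ D.level h k) :
    D.mulOp h r ψ ∈ D.level h k := by
  obtain ⟨H, hH, hG, hψ⟩ := hψ
  refine ⟨MvPolynomial.C r * H, ?_, fun n => ?_, fun n => ?_⟩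
  · simpa using (MvPolynomial.isWeightedHomogeneous_C (bideg (g := g)) r).mul hH
  · rw [psi_C_mul, psi_C_mul, hG]
    ring
  · rw [psi_C_mul, ← hψ]
    rfl

theorem level_shiftOp (hh : D.Admissible h) {k : ℕ} (i : Fin g) {ψ : (Fin g → ℤ) → L g}
    (hψ : ψ ∈ D.level h k) : shiftOp g i ψ ∈ D.level h (k + 1) := by
  obtain ⟨H, hH, hG, hψ⟩ := hψ
  have hr := ratio_ne_zero hh i
  refine ⟨H.map (D.shift h (Pi.single i 1)) * bilinPoly (D.fi h i),
    MvPolynomial.IsWeightedHomogeneous.mul (m := (k, k)) ?_ (bilinPoly_hom _), fun n => ?_, fun n => ?_⟩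
  · intro d hd
    apply hH
    intro h0
    apply hd
    rw [MvPolynomial.coeff_map, h0, map_zero]
  · rw [psi_shift _ _ _ _ _ _ hr.2.1, psi_shift _ _ _ _ _ _ hr.2.2, hG]
  · rw [psi_shift _ _ _ _ _ _ hr.1, ← hψ]
    rfl

theorem opRing_mem (hh : D.Admissible h) {T : Module.End ℂ ((Fin g → ℤ) → L g)}
    (hT : T ∈ D.opRing h) :
    ∀ ψ, (∃ k, ψ ∈ D.level h k) → ∃ k, T ψ ∈ D.level h k := by
  have hadd : ∀ ψ φ, (∃ k, ψ ∈ D.level h k) → (∃ k, φ ∈ D.level h k) →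
      ∃ k, ψ + φ ∈ D.level h k := by
    rintro ψ φ ⟨k, hk⟩ ⟨l, hl⟩
    exact ⟨max k l, level_add (level_mono (le_max_left k l) hk) (level_mono (le_max_right k l) hl)⟩
  induction hT using Subring.closure_induction with
  | mem T hT =>
    rintro ψ ⟨k, hk⟩
    rcases hT with ⟨r, rfl⟩ | ⟨i, rfl⟩
    · exact ⟨k, level_mulOp r hk⟩
    · exact ⟨k + 1, level_shiftOp hh i hk⟩
  | zero => exact fun _ _ => ⟨0, level_zero_mem 0⟩
  | one => exact fun _ hψ => hψ
  | add S T _ _ hS hT => exact fun ψ hψ => hadd _ _ (hS ψ hψ) (hT ψ hψ)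
  | neg T _ hT =>
    intro ψ hψ
    obtain ⟨k, hk⟩ := hT ψ hψ
    refine ⟨k, ?_⟩
    have : (-T) ψ = D.mulOp h (-1) (T ψ) := by
      funext n
      simp [mulOp, hat]
    rw [this]
    exact level_mulOp _ hk
  | mul S T _ _ hS hT => exact fun ψ hψ => hS _ (hT ψ hψ)

end aux

variable {h} in
/-- The discrete Baker–Akhiezer module `M̂_Λ = ⋃ k, M̂_Λ(k)`, as a module over `𝒯_g`. -/
def module (hh : D.Admissible h) : Submodule (D.opRing h) ((Fin g → ℤ) → L g) where
  carrier := ⋃ k, D.level h k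
  zero_mem' := Set.mem_iUnion.mpr ⟨0, level_zero_mem 0⟩
  add_mem' := by
    intro ψ φ hψ hφ
    obtain ⟨k, hk⟩ := Set.mem_iUnion.mp hψ
    obtain ⟨l, hl⟩ := Set.mem_iUnion.mp hφ
    exact Set.mem_iUnion.mpr ⟨max k l,
      level_add (level_mono (le_max_left k l) hk) (level_mono (le_max_right k l) hl)⟩
  smul_mem' := by
    intro T ψ hψ
    exact Set.mem_iUnion.mpr (opRing_mem hh T.2 ψ (Set.mem_iUnion.mp hψ))

end Data

end DBA

end

noncomputable section

namespace DBA

/-! An element of `M̂_Λ` is determined by its value at `n = 0`, because the coefficients of its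
numerator are translates of fixed elements of `𝒦` (`level_ext`). At `n = 0` the gluing condition
only says that the numerator `H`, of bidegree `(k, k)`, is glued with multiplier `λ₀ = Λ / w`, up to
the factor `A ^ k` coming from `f ^ k` (`psi_glue_iff`). In normal coordinates, where the two points
are `[1, 0]` and `[0, 1]`, `P` is diagonal with entries `μ_j` and `f = ∑ (μ_j x + y) τ_j`, such
numerators form the space `gluedSub μ λ₀ k` over `𝒦`. It has an explicit monomial basis and
dimension `k * (g+k-1).choose k`.

Take `h` with all `c_i h_i` equal to one number `ε`. The basis functions come from the `g` elements
`(λ₀ μ_j x + y) τ_j`. Applying `T^α` to one of them and evaluating at `0` multiplies the numerator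
by `∏ f_i ^ α_i` and divides the multiplier by `e^(ε|α|)`. Padding with powers of `f`, freeness
becomes the statement that in every degree `k + 1` the products of `k` factors among `f, f_1, …,
f_g` and one suitably twisted linear element form a `𝒦`-basis of `gluedSub μ λ₀ (k+1)`. The number
of products equals the dimension, so spanning suffices (`linearIndependent_prodFamily`).

Spanning reduces to degree 2, since degree `m + 1` is generated by degree 1 times degree `m` once
two different multipliers are allowed in degree 1 (`gluedSub_succ_le`). In degree 2 there are
`g(g+1)` products in a space of that dimension, so independence is needed. The matrix of
coefficients is polynomial in the multiplier `λ`; since `λ₀` is transcendental over `ℂ`, it is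
enough to treat one complex value of `λ`. There one lets `ε → 0`: all `f_i` tend to `f`, and after
replacing them by difference quotients the limit involves `f` and `∂_s F_i`. Its independence
follows from the assumed one, since the `μ_j` are distinct and nonzero
(`linearIndependent_relColDeriv`). Hence every small `ε ≠ 0` works. -/

theorem prod_pow_single_add {ι M : Type*} [Fintype ι] [DecidableEq ι] [CommMonoid M] (a : ι → M)
    (l : ι) (α : ι → ℕ) : ∏ i, a i ^ (Pi.single l 1 + α : ι → ℕ) i = a l * ∏ i, a i ^ α i := by
  simp only [Pi.add_apply, pow_add, Finset.prod_mul_distrib]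
  congr 1
  rw [Finset.prod_eq_single l]
  · simp
  · intro i _ hi
    simp [Pi.single_eq_of_ne hi]
  · simp

/-! ### Glued polynomials in normal coordinates: monomial basis, dimension, generation. -/

section Normalized

open MvPolynomial

variable {g : ℕ} {𝕜 : Type*} [Field 𝕜]

/-- The monomial `x ^ a * y ^ b * ∏ j, τ_j ^ α j`. -/
def bimon (𝕜 : Type*) [Field 𝕜] (a b : ℕ) (α : Fin g → ℕ) : MvPolynomial (Fin 2 ⊕ Fin g) 𝕜 :=
  X (Sum.inl 0) ^ a * X (Sum.inl 1) ^ b * ∏ j, X (Sum.inr j) ^ α j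

/-- The exponent of the monomial `x ^ a * y ^ b * ∏ j, τ_j ^ α j`. -/
def expo (a b : ℕ) (α : Fin g → ℕ) : (Fin 2 ⊕ Fin g) →₀ ℕ :=
  Finsupp.equivFunOnFinite.symm (Sum.elim ![a, b] α)

theorem bimon_eq_monomial (a b : ℕ) (α : Fin g → ℕ) :
    bimon 𝕜 a b α = monomial (expo a b α) 1 := by
  rw [monomial_eq, Finsupp.prod_fintype _ _ (fun _ => pow_zero _), Fintype.prod_sum_type,
    Fin.prod_univ_two]
  simp [bimon, expo]

theorem bimon_mul (a b a' b' : ℕ) (α α' : Fin g → ℕ) :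
    bimon 𝕜 a b α * bimon 𝕜 a' b' α' = bimon 𝕜 (a + a') (b + b') (α + α') := by
  simp only [bimon, Pi.add_apply, pow_add, Finset.prod_mul_distrib]
  ring

theorem expo_injective {a b a' b' : ℕ} {α α' : Fin g → ℕ} (h : expo a b α = expo a' b' α') :
    a = a' ∧ b = b' ∧ α = α' := by
  have h1 := fun i => DFunLike.congr_fun h i
  refine ⟨by simpa [expo] using h1 (Sum.inl 0), by simpa [expo] using h1 (Sum.inl 1), ?_⟩
  funext j
  simpa [expo] using h1 (Sum.inr j)

theorem coeff_bimon (a b a' b' : ℕ) (α α' : Fin g → ℕ) :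
    coeff (expo a' b' α') (bimon 𝕜 a b α) = if a = a' ∧ b = b' ∧ α = α' then 1 else 0 := by
  classical
  rw [bimon_eq_monomial, coeff_monomial]
  refine if_congr ⟨expo_injective, ?_⟩ rfl rfl
  rintro ⟨rfl, rfl, rfl⟩
  rfl

theorem weight_bideg (d : (Fin 2 ⊕ Fin g) →₀ ℕ) :
    Finsupp.weight bideg d = (d (Sum.inl 0) + d (Sum.inl 1), ∑ j, d (Sum.inr j)) := by
  rw [Finsupp.weight_eq_sum, Fintype.sum_sum_type, Fin.sum_univ_two]
  ext
  · simp [bideg, Prod.fst_sum]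
  · simp [bideg, Prod.snd_sum]

theorem bimon_hom (a b : ℕ) (α : Fin g → ℕ) :
    IsWeightedHomogeneous bideg (bimon 𝕜 a b α) (a + b, ∑ j, α j) := by
  rw [bimon_eq_monomial]
  refine isWeightedHomogeneous_monomial _ _ _ ?_
  rw [weight_bideg]
  simp [expo]

theorem eq_zero_of_coeff_expo {k l : ℕ} {G : MvPolynomial (Fin 2 ⊕ Fin g) 𝕜}
    (hG : IsWeightedHomogeneous bideg G (k, l))
    (h : ∀ a ≤ k, ∀ α : Fin g → ℕ, ∑ j, α j = l → coeff (expo a (k - a) α) G = 0) : G = 0 := by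
  ext d
  rw [coeff_zero]
  by_contra hd
  have h1 := hG hd
  rw [weight_bideg, Prod.mk.injEq] at h1
  apply hd
  rw [← h (d (Sum.inl 0)) (by omega) (fun j => d (Sum.inr j)) h1.2]
  congr 1
  ext i
  rcases i with i | i
  · fin_cases i
    · simp [expo]
    · simp [expo]; omega
  · simp [expo]

/-- Substitution of `(1, 0, τ)` for `(x, y, τ)`. -/
def evalFst : MvPolynomial (Fin 2 ⊕ Fin g) 𝕜 →ₐ[𝕜] MvPolynomial (Fin g) 𝕜 :=
  aeval (Sum.elim ![1, 0] X)

/-- Substitution of `(0, 1, μ τ)` for `(x, y, τ)`. -/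
def evalSnd (μ : Fin g → 𝕜) : MvPolynomial (Fin 2 ⊕ Fin g) 𝕜 →ₐ[𝕜] MvPolynomial (Fin g) 𝕜 :=
  aeval (Sum.elim ![0, 1] fun j => C (μ j) * X j)

/-- At `y = 0` only the monomials with `x ^ k` survive, and the exponent of `x` is forced by the
bidegree, so nothing is merged. -/
theorem coeff_evalFst {k l : ℕ} {G : MvPolynomial (Fin 2 ⊕ Fin g) 𝕜}
    (hG : IsWeightedHomogeneous bideg G (k, l)) (α : Fin g → ℕ) :
    coeff (Finsupp.equivFunOnFinite.symm α) (evalFst G) = coeff (expo k 0 α) G := by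
  classical
  conv_lhs => rw [G.as_sum]
  conv_rhs => rw [G.as_sum]
  rw [map_sum, coeff_sum, coeff_sum]
  refine Finset.sum_congr rfl fun d hd => ?_
  have h1 := hG (mem_support_iff.mp hd)
  rw [weight_bideg, Prod.mk.injEq] at h1
  rw [evalFst, aeval_monomial, Finsupp.prod_fintype _ _ (fun _ => pow_zero _),
    Fintype.prod_sum_type, Fin.prod_univ_two, coeff_monomial, algebraMap_eq]
  have h2 : ∏ j, (X j : MvPolynomial (Fin g) 𝕜) ^ d (Sum.inr j) =
      monomial (Finsupp.equivFunOnFinite.symm fun j => d (Sum.inr j)) 1 := by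
    rw [monomial_eq, Finsupp.prod_fintype _ _ (fun _ => pow_zero _)]
    simp
  simp only [Sum.elim_inl, Sum.elim_inr, h2, coeff_C_mul, Matrix.cons_val_zero,
    Matrix.cons_val_one, one_pow, one_mul]
  by_cases h3 : d (Sum.inl 1) = 0
  · rw [h3, pow_zero, one_mul, coeff_monomial, mul_ite, mul_one, mul_zero]
    refine if_congr ?_ rfl rfl
    rw [Equiv.apply_eq_iff_eq]
    constructor
    · rintro rfl
      ext i
      rcases i with i | i
      · fin_cases i
        · simp [expo]; omega
        · simp [expo, h3]
      · simp [expo]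
    · rintro rfl
      funext j
      simp [expo]
  · rw [zero_pow h3, zero_mul, coeff_zero, mul_zero, if_neg]
    rintro rfl
    exact h3 (by simp [expo])

theorem coeff_evalSnd (μ : Fin g → 𝕜) {k l : ℕ} {G : MvPolynomial (Fin 2 ⊕ Fin g) 𝕜}
    (hG : IsWeightedHomogeneous bideg G (k, l)) (α : Fin g → ℕ) :
    coeff (Finsupp.equivFunOnFinite.symm α) (evalSnd μ G) =
      (∏ j, μ j ^ α j) * coeff (expo 0 k α) G := by
  classical
  conv_lhs => rw [G.as_sum]
  conv_rhs => rw [G.as_sum]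
  rw [map_sum, coeff_sum, coeff_sum, Finset.mul_sum]
  refine Finset.sum_congr rfl fun d hd => ?_
  have h1 := hG (mem_support_iff.mp hd)
  rw [weight_bideg, Prod.mk.injEq] at h1
  rw [evalSnd, aeval_monomial, Finsupp.prod_fintype _ _ (fun _ => pow_zero _),
    Fintype.prod_sum_type, Fin.prod_univ_two, coeff_monomial, algebraMap_eq]
  have h2 : ∏ j, (C (μ j) * X j : MvPolynomial (Fin g) 𝕜) ^ d (Sum.inr j) =
      C (∏ j, μ j ^ d (Sum.inr j)) *
        monomial (Finsupp.equivFunOnFinite.symm fun j => d (Sum.inr j)) 1 := by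
    rw [monomial_eq, Finsupp.prod_fintype _ _ (fun _ => pow_zero _)]
    simp [mul_pow, Finset.prod_mul_distrib]
  simp only [Sum.elim_inl, Sum.elim_inr, h2, coeff_C_mul, Matrix.cons_val_zero,
    Matrix.cons_val_one, one_pow, mul_one]
  by_cases h3 : d (Sum.inl 0) = 0
  · rw [h3, pow_zero, one_mul, coeff_C_mul, coeff_monomial]
    by_cases h4 : (fun j => d (Sum.inr j)) = α
    · rw [if_pos (by rw [h4]), if_pos]
      · subst h4; ring
      · subst h4
        ext i
        rcases i with i | i
        · fin_cases i
          · simp [expo, h3]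
          · simp [expo]; omega
        · simp [expo]
    · rw [if_neg (by rwa [Equiv.apply_eq_iff_eq]), if_neg]
      · ring
      · rintro rfl
        exact h4 (by funext j; simp [expo])
  · rw [zero_pow h3, zero_mul, coeff_zero, mul_zero, if_neg, mul_zero]
    rintro rfl
    exact h3 (by simp [expo])

/-- Polynomials `G` of bidegree `(k, k)` with `G(1, 0, τ) = lam * G(0, 1, μ τ)`. -/
def gluedSub (μ : Fin g → 𝕜) (lam : 𝕜) (k : ℕ) :
    Submodule 𝕜 (MvPolynomial (Fin 2 ⊕ Fin g) 𝕜) :=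
  weightedHomogeneousSubmodule 𝕜 bideg (k, k) ⊓
    LinearMap.ker (evalFst.toLinearMap - lam • (evalSnd μ).toLinearMap)

theorem mem_gluedSub {μ : Fin g → 𝕜} {lam : 𝕜} {k : ℕ} {G : MvPolynomial (Fin 2 ⊕ Fin g) 𝕜} :
    G ∈ gluedSub μ lam k ↔
      IsWeightedHomogeneous bideg G (k, k) ∧ evalFst G = C lam * evalSnd μ G := by
  simp [gluedSub, sub_eq_zero, smul_eq_C_mul]

theorem gluedSub_mul {μ : Fin g → 𝕜} {lam ρ : 𝕜} {k l : ℕ} :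
    gluedSub μ lam k * gluedSub μ ρ l ≤ gluedSub μ (lam * ρ) (k + l) := by
  rw [Submodule.mul_le]
  intro G hG H hH
  rw [mem_gluedSub] at hG hH ⊢
  refine ⟨hG.1.mul hH.1, ?_⟩
  rw [map_mul evalFst, map_mul (evalSnd μ), hG.2, hH.2, C_mul]
  ring

theorem evalFst_bimon (a b : ℕ) (α : Fin g → ℕ) :
    evalFst (bimon 𝕜 a b α) = 0 ^ b * ∏ j, X j ^ α j := by
  simp [evalFst, bimon]

theorem evalSnd_bimon (μ : Fin g → 𝕜) (a b : ℕ) (α : Fin g → ℕ) :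
    evalSnd μ (bimon 𝕜 a b α) = 0 ^ a * (C (∏ j, μ j ^ α j) * ∏ j, X j ^ α j) := by
  simp [evalSnd, bimon, mul_pow, Finset.prod_mul_distrib]

/-- The members of the monomial basis of `gluedSub μ lam k` that do not vanish at
`x = 0` and `y = 0`. -/
def bdry (μ : Fin g → 𝕜) (lam : 𝕜) (k : ℕ) (α : Fin g → ℕ) :
    MvPolynomial (Fin 2 ⊕ Fin g) 𝕜 :=
  C (lam * ∏ j, μ j ^ α j) * bimon 𝕜 k 0 α + bimon 𝕜 0 k α

theorem bdry_mem (μ : Fin g → 𝕜) (lam : 𝕜) {k : ℕ} (hk : k ≠ 0) {α : Fin g → ℕ}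
    (hα : ∑ j, α j = k) : bdry μ lam k α ∈ gluedSub μ lam k := by
  rw [mem_gluedSub]
  constructor
  · refine IsWeightedHomogeneous.add ?_ ?_
    · have h := (isWeightedHomogeneous_C (bideg (g := g)) (lam * ∏ j, μ j ^ α j)).mul
        (bimon_hom (𝕜 := 𝕜) k 0 α)
      simpa [hα] using h
    · simpa [hα] using bimon_hom (𝕜 := 𝕜) 0 k α
  · have h1 (r : 𝕜) : evalFst (g := g) (C r) = C r := evalFst.commutes r
    have h2 (r : 𝕜) : evalSnd μ (C r) = C r := (evalSnd μ).commutes r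
    rw [bdry, map_add, map_add, map_mul evalFst, map_mul (evalSnd μ), h1, h2, evalFst_bimon, evalFst_bimon,
      evalSnd_bimon, evalSnd_bimon, zero_pow hk]
    simp only [pow_zero, map_mul C]
    ring

theorem bimon_mem (μ : Fin g → 𝕜) (lam : 𝕜) {a b k : ℕ} (ha : a ≠ 0) (hb : b ≠ 0)
    (hab : a + b = k) {α : Fin g → ℕ} (hα : ∑ j, α j = k) :
    bimon 𝕜 a b α ∈ gluedSub μ lam k := by
  rw [mem_gluedSub]
  refine ⟨by simpa [hab, hα] using bimon_hom (𝕜 := 𝕜) a b α, ?_⟩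
  simp [evalFst_bimon, evalSnd_bimon, ha, hb]

/-- Gluing expresses the coefficients at `x ^ k` through those at `y ^ k`, so the exponents `a < k`
of `x` already determine `G`. -/
theorem eq_zero_of_mem_gluedSub {μ : Fin g → 𝕜} {lam : 𝕜} {k : ℕ}
    {G : MvPolynomial (Fin 2 ⊕ Fin g) 𝕜} (hk : k ≠ 0) (hG : G ∈ gluedSub μ lam k)
    (h : ∀ a < k, ∀ α : Fin g → ℕ, ∑ j, α j = k → coeff (expo a (k - a) α) G = 0) : G = 0 := by
  rw [mem_gluedSub] at hG
  refine eq_zero_of_coeff_expo hG.1 fun a ha α hα => ?_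
  rcases ha.lt_or_eq with h1 | rfl
  · exact h a h1 α hα
  · have h2 := congrArg (coeff (Finsupp.equivFunOnFinite.symm α)) hG.2
    have h3 := h 0 (Nat.pos_of_ne_zero hk) α hα
    rw [Nat.sub_zero] at h3
    rw [coeff_evalFst hG.1, coeff_C_mul, coeff_evalSnd μ hG.1, h3, mul_zero, mul_zero] at h2
    rwa [Nat.sub_self]

variable (ι : Type*) [Fintype ι] (k : ℕ) in
/-- Exponents of monomials of degree `k` in variables indexed by `ι`. -/
abbrev Exps : Type _ := {α : ι → ℕ // ∑ i, α i = k}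

instance (ι : Type*) [Fintype ι] [DecidableEq ι] (k : ℕ) : Fintype (Exps ι k) :=
  Fintype.ofEquiv _ (Sym.equivNatSumOfFintype ι k)

theorem card_exps (ι : Type*) [Fintype ι] [DecidableEq ι] (k : ℕ) :
    Fintype.card (Exps ι k) = (Fintype.card ι + k - 1).choose k := by
  rw [← Sym.card_sym_eq_choose]
  exact Fintype.card_congr (Sym.equivNatSumOfFintype ι k).symm

/-- The monomial basis of `gluedSub μ lam k`. -/
def monFamily (μ : Fin g → 𝕜) (lam : 𝕜) (k : ℕ) (i : Fin k × Exps (Fin g) k) :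
    MvPolynomial (Fin 2 ⊕ Fin g) 𝕜 :=
  if (i.1 : ℕ) = 0 then bdry μ lam k i.2 else bimon 𝕜 i.1 (k - i.1) i.2

theorem monFamily_mem (μ : Fin g → 𝕜) (lam : 𝕜) (k : ℕ) (i : Fin k × Exps (Fin g) k) :
    monFamily μ lam k i ∈ gluedSub μ lam k := by
  have := i.1.2
  rw [monFamily]
  split_ifs with h
  · exact bdry_mem _ _ (by omega) i.2.2
  · exact bimon_mem _ _ h (by omega) (by omega) i.2.2

/-- The coefficients at `x ^ a * y ^ (k - a)` with `a < k` are the dual coordinates: index `a = 0`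
stands for the boundary element, whose `x ^ k` term is invisible to them. -/
theorem coeff_monFamily (μ : Fin g → 𝕜) (lam : 𝕜) (k : ℕ) (i j : Fin k × Exps (Fin g) k) :
    coeff (expo j.1 (k - j.1) j.2) (monFamily μ lam k i) = if i = j then 1 else 0 := by
  obtain ⟨⟨a, ha⟩, α⟩ := i
  obtain ⟨⟨b, hb⟩, β⟩ := j
  rw [monFamily]
  simp only [Prod.mk.injEq, Fin.mk.injEq, Subtype.ext_iff]
  split_ifs with h1 h2 h2
  · obtain ⟨rfl, h2⟩ := h2
    subst h1
    rw [bdry, coeff_add, coeff_C_mul, coeff_bimon, coeff_bimon, if_neg (by omega),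
      if_pos ⟨rfl, rfl, h2⟩]
    ring
  · subst h1
    rw [bdry, coeff_add, coeff_C_mul, coeff_bimon, coeff_bimon, if_neg (by omega), if_neg]
    · ring
    · rintro ⟨h3, -, h4⟩
      exact h2 ⟨h3, h4⟩
  · obtain ⟨rfl, h2⟩ := h2
    rw [coeff_bimon, if_pos ⟨rfl, rfl, h2⟩]
  · rw [coeff_bimon, if_neg]
    rintro ⟨h3, -, h4⟩
    exact h2 ⟨h3, h4⟩

theorem linearIndependent_monFamily (μ : Fin g → 𝕜) (lam : 𝕜) (k : ℕ) :
    LinearIndependent 𝕜 (monFamily μ lam k) := by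
  rw [Fintype.linearIndependent_iff]
  intro r hr j
  have h := congrArg (coeff (expo j.1 (k - j.1) j.2)) hr
  simpa [coeff_sum, coeff_smul, coeff_monFamily] using h

theorem span_monFamily (μ : Fin g → 𝕜) (lam : 𝕜) {k : ℕ} (hk : k ≠ 0) :
    Submodule.span 𝕜 (Set.range (monFamily μ lam k)) = gluedSub μ lam k := by
  apply le_antisymm
  · rw [Submodule.span_le]
    rintro _ ⟨i, rfl⟩
    exact monFamily_mem _ _ _ _
  · intro G hG
    have h : G = ∑ i : Fin k × Exps (Fin g) k,
        coeff (expo i.1 (k - i.1) i.2) G • monFamily μ lam k i := by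
      rw [← sub_eq_zero]
      refine eq_zero_of_mem_gluedSub hk (Submodule.sub_mem _ hG (Submodule.sum_mem _ fun i _ =>
        Submodule.smul_mem _ _ (monFamily_mem _ _ _ _))) fun a ha α hα => ?_
      have h1 := coeff_monFamily μ lam k (j := (⟨a, ha⟩, ⟨α, hα⟩))
      simp only at h1
      simp [coeff_sub, coeff_sum, coeff_smul, h1]
    rw [h]
    exact Submodule.sum_mem _ fun i _ => Submodule.smul_mem _ _ (Submodule.subset_span ⟨i, rfl⟩)

theorem finrank_gluedSub (μ : Fin g → 𝕜) (lam : 𝕜) {k : ℕ} (hk : k ≠ 0) :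
    Module.finrank 𝕜 (gluedSub μ lam k) = k * (g + k - 1).choose k := by
  rw [← span_monFamily μ lam hk, finrank_span_eq_card (linearIndependent_monFamily μ lam k),
    Fintype.card_prod, Fintype.card_fin, card_exps, Fintype.card_fin]

instance finite_gluedSub (μ : Fin g → 𝕜) (lam : 𝕜) {k : ℕ} [NeZero k] :
    Module.Finite 𝕜 (gluedSub μ lam k) := by
  rw [← span_monFamily μ lam (NeZero.ne k)]
  exact FiniteDimensional.span_of_finite 𝕜 (Set.finite_range _)

/-- The element `(lam * μ j * x + y) * τ_j` of `gluedSub μ lam 1`. -/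
def linElt (μ : Fin g → 𝕜) (lam : 𝕜) (j : Fin g) : MvPolynomial (Fin 2 ⊕ Fin g) 𝕜 :=
  (C (lam * μ j) * X (Sum.inl 0) + X (Sum.inl 1)) * X (Sum.inr j)

theorem bimon_single (a b : ℕ) (j : Fin g) :
    bimon 𝕜 a b (Pi.single j 1) = X (Sum.inl 0) ^ a * X (Sum.inl 1) ^ b * X (Sum.inr j) := by
  rw [bimon, Finset.prod_eq_single j]
  · simp
  · intro i _ hi
    simp [Pi.single_eq_of_ne hi]
  · simp

theorem linElt_eq (μ : Fin g → 𝕜) (lam : 𝕜) (j : Fin g) :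
    linElt μ lam j = bdry μ lam 1 (Pi.single j 1) := by
  rw [bdry, bimon_single, bimon_single, linElt, Finset.prod_eq_single j]
  · simp
    ring
  · intro i _ hi
    simp [Pi.single_eq_of_ne hi]
  · simp

theorem linElt_mem (μ : Fin g → 𝕜) (lam : 𝕜) (j : Fin g) :
    linElt μ lam j ∈ gluedSub μ lam 1 := by
  rw [linElt_eq]
  exact bdry_mem _ _ one_ne_zero (by simp)

theorem span_linElt (μ : Fin g → 𝕜) (lam : 𝕜) :
    Submodule.span 𝕜 (Set.range (linElt μ lam)) = gluedSub μ lam 1 := by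
  apply le_antisymm
  · rw [Submodule.span_le]
    rintro _ ⟨i, rfl⟩
    exact linElt_mem _ _ _
  · rw [← span_monFamily μ lam one_ne_zero, Submodule.span_le]
    rintro _ ⟨⟨a, α⟩, rfl⟩
    have ha : a = 0 := Subsingleton.elim _ _
    subst ha
    obtain ⟨α, hα⟩ := α
    obtain ⟨j, hj⟩ : ∃ j, α j ≠ 0 := by
      by_contra! h
      simp [h] at hα
    have hαj : α = Pi.single j 1 := by
      rw [← Finset.add_sum_erase _ _ (Finset.mem_univ j)] at hα
      have h0 : ∑ i ∈ Finset.univ.erase j, α i = 0 := by omega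
      rw [Finset.sum_eq_zero_iff] at h0
      funext i
      by_cases hi : i = j
      · subst hi
        rw [Pi.single_eq_same]
        omega
      · rw [Pi.single_eq_of_ne hi, h0 i (Finset.mem_erase.mpr ⟨hi, Finset.mem_univ i⟩)]
    refine Submodule.subset_span ⟨j, ?_⟩
    simp only [linElt_eq, monFamily, hαj, Fin.val_zero, if_true]

/-- A composition of `m + 1` is the sum of a unit vector and of a composition of `m`. -/
theorem exists_eq_single_add {m : ℕ} {α : Fin g → ℕ} (hα : ∑ j, α j = m + 1) :
    ∃ j, ∃ β : Fin g → ℕ, ∑ j, β j = m ∧ α = Pi.single j 1 + β := by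
  obtain ⟨j, hj⟩ : ∃ j, α j ≠ 0 := by
    by_contra! h
    simp [h] at hα
  have h : α = Pi.single j 1 + (α - Pi.single j 1) := by
    funext i
    by_cases hi : i = j
    · subst hi
      simp
      omega
    · simp [Pi.single_eq_of_ne hi]
  refine ⟨j, α - Pi.single j 1, ?_, h⟩
  rw [h] at hα
  simp only [Pi.add_apply, Finset.sum_add_distrib, Finset.sum_pi_single', Finset.mem_univ,
    if_true] at hα
  simp at hα ⊢
  omega

/-- Monomials containing both `x` and `y` are glued for every multiplier. Multiplying one of them by
`(μ_j x + y) τ_j` and by `(ρ μ_j x + y) τ_j` gives two independent combinations of the same two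
monomials, so each of these is obtained separately; boundary elements then follow modulo mixed
monomials. -/
theorem gluedSub_succ_le {μ : Fin g → 𝕜} (hμ : ∀ j, μ j ≠ 0) {lam ρ : 𝕜}
    (hρ1 : ρ ≠ 1) {m : ℕ} (hm : 2 ≤ m) :
    gluedSub μ lam (m + 1) ≤
      gluedSub μ 1 1 * gluedSub μ lam m ⊔ gluedSub μ ρ 1 * gluedSub μ (lam / ρ) m := by
  set S := gluedSub μ 1 1 * gluedSub μ lam m ⊔ gluedSub μ ρ 1 * gluedSub μ (lam / ρ) m with hS
  have hlin (σ : 𝕜) (a b : ℕ) (j : Fin g) (α : Fin g → ℕ) : linElt μ σ j * bimon 𝕜 a b α =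
      (σ * μ j) • bimon 𝕜 (a + 1) b (Pi.single j 1 + α) +
        bimon 𝕜 a (b + 1) (Pi.single j 1 + α) := by
    have h1 := bimon_mul (𝕜 := 𝕜) 1 0 a b (Pi.single j 1) α
    have h2 := bimon_mul (𝕜 := 𝕜) 0 1 a b (Pi.single j 1) α
    rw [add_comm a, add_comm b]
    rw [zero_add] at h1 h2
    rw [← h1, ← h2, bimon_single, bimon_single, linElt, smul_eq_C_mul]
    ring
  have hint : ∀ a b, a ≠ 0 → b ≠ 0 → a + b = m → ∀ j : Fin g, ∀ α : Fin g → ℕ, ∑ j, α j = m →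
      bimon 𝕜 (a + 1) b (Pi.single j 1 + α) ∈ S ∧ bimon 𝕜 a (b + 1) (Pi.single j 1 + α) ∈ S := by
    intro a b ha hb hab j α hα
    have h1 : linElt μ 1 j * bimon 𝕜 a b α ∈ S :=
      Submodule.mem_sup_left (Submodule.mul_mem_mul (linElt_mem _ _ _)
        (bimon_mem _ _ ha hb hab hα))
    have h2 : linElt μ ρ j * bimon 𝕜 a b α ∈ S :=
      Submodule.mem_sup_right (Submodule.mul_mem_mul (linElt_mem _ _ _)
        (bimon_mem _ _ ha hb hab hα))
    rw [hlin] at h1 h2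
    have h3 : bimon 𝕜 (a + 1) b (Pi.single j 1 + α) ∈ S := by
      -- The two products differ by `(ρ - 1) * μ j` times the first monomial.
      have h4 := Submodule.smul_mem _ ((ρ - 1) * μ j)⁻¹ (Submodule.sub_mem _ h2 h1)
      rwa [add_sub_add_right_eq_sub, ← sub_smul, smul_smul, one_mul, ← sub_one_mul,
        inv_mul_cancel₀ (mul_ne_zero (sub_ne_zero.mpr hρ1) (hμ j)), one_smul] at h4
    refine ⟨h3, ?_⟩
    have h5 := Submodule.sub_mem _ h1 (Submodule.smul_mem _ (1 * μ j) h3)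
    rwa [add_sub_cancel_left] at h5
  rw [← span_monFamily μ lam (Nat.succ_ne_zero m), Submodule.span_le]
  rintro _ ⟨⟨⟨a, ha⟩, ⟨α, hα⟩⟩, rfl⟩
  obtain ⟨j, β, hβ, rfl⟩ := exists_eq_single_add hα
  simp only [monFamily, SetLike.mem_coe]
  split_ifs with h0
  · have h1 : linElt μ 1 j * bdry μ lam m β ∈ S :=
      Submodule.mem_sup_left (Submodule.mul_mem_mul (linElt_mem _ _ _)
        (bdry_mem _ _ (by omega) hβ))
    have h2 := prod_pow_single_add μ j β
    -- The cross terms are `x ^ m * y` and `x * y ^ m`; `hint` reaches them because `m - 1 ≠ 0`.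
    have h3 : bdry μ lam (m + 1) (Pi.single j 1 + β) = linElt μ 1 j * bdry μ lam m β -
        ((lam * ∏ i, μ i ^ β i) • bimon 𝕜 (m - 1 + 1) 1 (Pi.single j 1 + β) +
          (1 * μ j) • bimon 𝕜 1 (m - 1 + 1) (Pi.single j 1 + β)) := by
      rw [bdry, bdry, mul_add, mul_left_comm, hlin, hlin, h2, Nat.sub_add_cancel (by omega)]
      simp only [smul_eq_C_mul, C_mul, C_1, zero_add]
      ring
    rw [h3]
    refine Submodule.sub_mem _ h1 (Submodule.add_mem _ (Submodule.smul_mem _ _ ?_)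
      (Submodule.smul_mem _ _ ?_))
    · exact (hint (m - 1) 1 (by omega) (by omega) (by omega) j β hβ).1
    · exact (hint 1 (m - 1) (by omega) (by omega) (by omega) j β hβ).2
  · by_cases h1 : a = 1
    · subst h1
      have h2 := (hint 1 (m - 1) (by omega) (by omega) (by omega) j β hβ).2
      rwa [show m - 1 + 1 = m + 1 - 1 by omega] at h2
    · have h2 := (hint (a - 1) (m + 1 - a) (by omega) (by omega) (by omega) j β hβ).1
      rwa [show a - 1 + 1 = a by omega] at h2

end Normalized

/-! ### Reduction of spanning and independence to degree two. -/

section Spanning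

open MvPolynomial

variable {g : ℕ} {𝕜 : Type*} [Field 𝕜]

/-- By `gluedSub_succ_le` and induction, an element of the next degree is a sum of products of an
element of degree 1, some `F l` and a glued factor. The degree 1 element is absorbed into the glued
factor, and the multipliers `ρ` and `1 / ρ` cancel. -/
theorem gluedSub_le_iSup_of_two {ι : Type*} {μ : Fin g → 𝕜} (hμ : ∀ j, μ j ≠ 0)
    (F : ι → MvPolynomial (Fin 2 ⊕ Fin g) 𝕜) (E : ι → 𝕜) {S : Set 𝕜} {ρ : 𝕜} (hρ0 : ρ ≠ 0)
    (hρ1 : ρ ≠ 1) (hS : ∀ lam ∈ S, lam / ρ ∈ S)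
    (h2 : ∀ lam ∈ S, gluedSub μ lam 2 ≤
      ⨆ l, Submodule.span 𝕜 {F l} * gluedSub μ (lam / E l) 1) (k : ℕ) :
    ∀ lam ∈ S, gluedSub μ lam (k + 2) ≤
      ⨆ l, Submodule.span 𝕜 {F l} * gluedSub μ (lam / E l) (k + 1) := by
  induction k with
  | zero => exact h2
  | succ k ih =>
    intro lam hlam
    refine (gluedSub_succ_le hμ hρ1 (by omega)).trans (sup_le ?_ ?_)
    · refine (mul_le_mul' le_rfl (ih lam hlam)).trans ?_
      rw [Submodule.mul_iSup]
      refine iSup_mono fun l => ?_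
      rw [mul_left_comm]
      refine mul_le_mul' le_rfl (gluedSub_mul.trans ?_)
      rw [one_mul, add_comm 1]
    · refine (mul_le_mul' le_rfl (ih _ (hS lam hlam))).trans ?_
      rw [Submodule.mul_iSup]
      refine iSup_mono fun l => ?_
      rw [mul_left_comm]
      refine mul_le_mul' le_rfl (gluedSub_mul.trans ?_)
      rw [div_right_comm, mul_div_cancel₀ _ hρ0, add_comm 1]

/-- The products of `k` of the `F l` and of a member of the basis of `gluedSub μ _ 1`. -/
def prodFamily {ι : Type*} [Fintype ι] (μ : Fin g → 𝕜)
    (F : ι → MvPolynomial (Fin 2 ⊕ Fin g) 𝕜) (E : ι → 𝕜) (lam : 𝕜) (k : ℕ)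
    (i : Exps ι k × Fin g) : MvPolynomial (Fin 2 ⊕ Fin g) 𝕜 :=
  (∏ l, F l ^ i.1.1 l) * linElt μ (lam / ∏ l, E l ^ i.1.1 l) i.2

/-- One factor `F l` is split off at a time until degree 1 is reached. The multiplier changes at
every step, hence the statement for a whole set `S` closed under these changes. -/
theorem gluedSub_le_span_prodFamily {ι : Type*} [Fintype ι] [DecidableEq ι] {μ : Fin g → 𝕜}
    (hμ : ∀ j, μ j ≠ 0) (F : ι → MvPolynomial (Fin 2 ⊕ Fin g) 𝕜) (E : ι → 𝕜) {S : Set 𝕜} {ρ : 𝕜}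
    (hρ0 : ρ ≠ 0) (hρ1 : ρ ≠ 1) (hS : ∀ lam ∈ S, lam / ρ ∈ S)
    (hSE : ∀ lam ∈ S, ∀ l, lam / E l ∈ S)
    (h2 : ∀ lam ∈ S, gluedSub μ lam 2 ≤
      ⨆ l, Submodule.span 𝕜 {F l} * gluedSub μ (lam / E l) 1) (k : ℕ) :
    ∀ lam ∈ S, gluedSub μ lam (k + 1) ≤
      Submodule.span 𝕜 (Set.range (prodFamily μ F E lam k)) := by
  induction k with
  | zero =>
    intro lam _
    rw [zero_add, ← span_linElt μ lam, Submodule.span_le]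
    rintro _ ⟨j, rfl⟩
    refine Submodule.subset_span ⟨(⟨0, by simp⟩, j), ?_⟩
    simp [prodFamily]
  | succ k ih =>
    intro lam hlam
    refine (gluedSub_le_iSup_of_two hμ F E hρ0 hρ1 hS h2 k lam hlam).trans (iSup_le fun l => ?_)
    refine (mul_le_mul' le_rfl (ih _ (hSE lam hlam l))).trans ?_
    rw [Submodule.span_mul_span, Submodule.span_le]
    rintro _ ⟨_, rfl, _, ⟨⟨α, j⟩, rfl⟩, rfl⟩
    refine Submodule.subset_span ⟨(⟨Pi.single l 1 + α.1, ?_⟩, j), ?_⟩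
    · have := α.2
      simp [Finset.sum_add_distrib, this, add_comm]
    · simp only [prodFamily, prod_pow_single_add, div_div, mul_assoc]

/-- A family whose span contains a space of dimension at least its cardinality is independent. -/
theorem linearIndependent_prodFamily {ι : Type*} [Fintype ι] [DecidableEq ι]
    (hι : Fintype.card ι = g + 1) {μ : Fin g → 𝕜}
    {F : ι → MvPolynomial (Fin 2 ⊕ Fin g) 𝕜} {E : ι → 𝕜} {lam : 𝕜} {k : ℕ}
    (h : gluedSub μ lam (k + 1) ≤ Submodule.span 𝕜 (Set.range (prodFamily μ F E lam k))) :
    LinearIndependent 𝕜 (prodFamily μ F E lam k) := by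
  rw [linearIndependent_iff_card_le_finrank_span, Set.finrank]
  have : Module.Finite 𝕜 (Submodule.span 𝕜 (Set.range (prodFamily μ F E lam k))) :=
    FiniteDimensional.span_of_finite 𝕜 (Set.finite_range _)
  refine le_trans (le_of_eq ?_) (Submodule.finrank_mono h)
  rw [finrank_gluedSub _ _ (Nat.succ_ne_zero k), Fintype.card_prod, card_exps, hι, Fintype.card_fin]
  -- The count is `g * (g+k).choose k = (k+1) * (g+k).choose (k+1)`.
  have h1 := Nat.choose_succ_right_eq (g + k) k
  rw [Nat.add_sub_cancel] at h1
  rw [show g + 1 + k - 1 = g + k by omega, show g + (k + 1) - 1 = g + k by omega, ← h1, mul_comm]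

/-- The bilinear form with coefficients `φ k` on the basis of `gluedSub μ E 1`. -/
def linForm (μ φ : Fin g → 𝕜) (E : 𝕜) : MvPolynomial (Fin 2 ⊕ Fin g) 𝕜 :=
  ∑ k, C (φ k) * linElt μ E k

theorem linForm_mem (μ φ : Fin g → 𝕜) (E : 𝕜) : linForm μ φ E ∈ gluedSub μ E 1 := by
  refine Submodule.sum_mem _ fun k _ => ?_
  rw [← smul_eq_C_mul]
  exact Submodule.smul_mem _ _ (linElt_mem _ _ _)

/-- Independent products span, because there are `(g + 1) * g` of them and this is the dimension in
degree two. -/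
theorem gluedSub_two_le_iSup {ι : Type*} [Fintype ι] (hι : Fintype.card ι = g + 1)
    {μ : Fin g → 𝕜} {φ : ι → Fin g → 𝕜} {E : ι → 𝕜} (hE : ∀ l, E l ≠ 0) {lam : 𝕜}
    (h : LinearIndependent 𝕜 fun i : ι × Fin g =>
      linForm μ (φ i.1) (E i.1) * linElt μ (lam / E i.1) i.2) :
    gluedSub μ lam 2 ≤
      ⨆ l, Submodule.span 𝕜 {linForm μ (φ l) (E l)} * gluedSub μ (lam / E l) 1 := by
  have hle : Submodule.span 𝕜 (Set.range fun i : ι × Fin g =>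
      linForm μ (φ i.1) (E i.1) * linElt μ (lam / E i.1) i.2) ≤ gluedSub μ lam 2 := by
    rw [Submodule.span_le]
    rintro _ ⟨i, rfl⟩
    have h1 := gluedSub_mul (Submodule.mul_mem_mul (linForm_mem μ (φ i.1) (E i.1))
      (linElt_mem μ (lam / E i.1) i.2))
    rwa [mul_div_cancel₀ _ (hE _)] at h1
  have h2 := Submodule.eq_of_le_of_finrank_le hle (by
    rw [finrank_span_eq_card h, finrank_gluedSub _ _ two_ne_zero, Fintype.card_prod, hι,
      Fintype.card_fin, show g + 2 - 1 = g + 1 by omega, mul_comm 2]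
    have h3 := Nat.choose_succ_right_eq (g + 1) 1
    simp at h3
    omega)
  rw [← h2, Submodule.span_le]
  rintro _ ⟨i, rfl⟩
  exact Submodule.mem_iSup_of_mem i.1
    (Submodule.mul_mem_mul (Submodule.mem_span_singleton_self _) (linElt_mem _ _ _))

end Spanning

/-! ### Relations in degree two as a linear system polynomial in the multiplier. -/

section Relations

open MvPolynomial

variable {g : ℕ}

theorem add_swap_eq_zero_of_quadratic {A : Type*} [CommRing A] {B : Matrix (Fin g) (Fin g) A}
    (h : ∀ τ : Fin g → A, τ ⬝ᵥ (B *ᵥ τ) = 0) (i j : Fin g) : B i j + B j i = 0 := by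
  have h1 := h (Pi.single i 1 + Pi.single j 1)
  have h2 (i j : Fin g) : (Pi.single i 1 : Fin g → A) ⬝ᵥ (B *ᵥ Pi.single j 1) = B i j := by simp
  have h3 := h (Pi.single i 1)
  have h4 := h (Pi.single j 1)
  rw [Matrix.mulVec_add, dotProduct_add, add_dotProduct, add_dotProduct, h3, h4, h2, h2] at h1
  linear_combination h1

/-- The contribution of the `i`-th row of a matrix to the symmetric part of the matrix. -/
def pairCol {A : Type*} [AddCommMonoid A] (ψ : Fin g → Fin g → A) (i : Fin g)
    (p : Fin g × Fin g) : A :=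
  (if i = p.1 then ψ p.1 p.2 else 0) + (if i = p.2 then ψ p.2 p.1 else 0)

theorem sum_mul_pairCol {A : Type*} [CommRing A] {ι : Type*} [Fintype ι] (r : ι × Fin g → A)
    (ψ : ι → Fin g → Fin g → A) (p : Fin g × Fin g) :
    ∑ i, r i * pairCol (ψ i.1) i.2 p =
      (∑ l, r (l, p.1) * ψ l p.1 p.2) + ∑ l, r (l, p.2) * ψ l p.2 p.1 := by
  rw [Fintype.sum_prod_type, ← Finset.sum_add_distrib]
  refine Finset.sum_congr rfl fun l _ => ?_
  simp [pairCol, mul_add, Finset.sum_add_distrib]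

/-- The coefficients of `y ^ 2` and of `x * y` in the product of
`∑ k, φ k * (E * μ k * x + y) * τ_k` and of `(lam * E' * μ i * x + y) * τ_i`. -/
def relCol {A : Type*} [CommRing A] (μ φ : Fin g → A) (E E' lam : A) (i : Fin g) :
    (Fin g × Fin g) ⊕ (Fin g × Fin g) → A :=
  Sum.elim (pairCol (fun _ k => φ k) i)
    (pairCol (fun j k => φ k * (E * μ k + lam * E' * μ j)) i)

theorem map_relCol {A B : Type*} [CommRing A] [CommRing B] (f : A →+* B) (μ φ : Fin g → A)
    (E E' lam : A) (i : Fin g) (p : (Fin g × Fin g) ⊕ (Fin g × Fin g)) :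
    f (relCol μ φ E E' lam i p) =
      relCol (fun k => f (μ k)) (fun k => f (φ k)) (f E) (f E') (f lam) i p := by
  rcases p with p | p <;> simp [relCol, pairCol, apply_ite f]

/-- For fixed `x, y` the relation is a vanishing quadratic form in `τ`, so the symmetric part of its
matrix is zero; its `y ^ 2` and `x * y` coefficients are the rows of `relCol`. -/
theorem relCol_relation {𝕜 : Type*} [Field 𝕜] {ι : Type*} [Fintype ι]
    {μ : Fin g → 𝕜} {φ : ι → Fin g → 𝕜} {E : ι → 𝕜} (hE : ∀ l, E l ≠ 0) {lam : 𝕜}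
    {r : ι × Fin g → 𝕜}
    (hr : ∑ i, r i • (linForm μ (φ i.1) (E i.1) * linElt μ (lam / E i.1) i.2) = 0)
    (p : (Fin g × Fin g) ⊕ (Fin g × Fin g)) :
    ∑ i, r i * relCol μ (φ i.1) (E i.1) (E i.1)⁻¹ lam i.2 p = 0 := by
  have key (x y : 𝕜) (j k : Fin g) :
      (∑ l, r (l, j) * (φ l k * (E l * μ k * x + y) * (lam / E l * μ j * x + y))) +
      ∑ l, r (l, k) * (φ l j * (E l * μ j * x + y) * (lam / E l * μ k * x + y)) = 0 := by
    refine add_swap_eq_zero_of_quadratic (B := Matrix.of fun j k =>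
      ∑ l, r (l, j) * (φ l k * (E l * μ k * x + y) * (lam / E l * μ j * x + y))) (fun τ => ?_) j k
    have h := congrArg (eval (Sum.elim ![x, y] τ)) hr
    rw [map_zero] at h
    rw [← h]
    simp only [linForm, linElt, map_sum, smul_eval, map_mul, map_add, eval_C, eval_X,
      Sum.elim_inl, Sum.elim_inr, Matrix.cons_val_zero, Matrix.cons_val_one]
    rw [Fintype.sum_prod_type, Finset.sum_comm]
    simp only [dotProduct, Matrix.mulVec, Matrix.of_apply, Finset.sum_mul, Finset.mul_sum]
    refine Finset.sum_congr rfl fun i _ => ?_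
    rw [Finset.sum_comm]
    refine Finset.sum_congr rfl fun l _ => Finset.sum_congr rfl fun k _ => ?_
    ring
  rcases p with p | p
  · simp only [relCol, Sum.elim_inl]
    rw [sum_mul_pairCol r fun l _ k => φ l k]
    simpa using key 0 1 p.1 p.2
  · simp only [relCol, Sum.elim_inr]
    rw [sum_mul_pairCol r fun l j k => φ l k * (E l * μ k + lam * (E l)⁻¹ * μ j)]
    have h1 := key 1 1 p.1 p.2
    have h2 := key 0 1 p.1 p.2
    rw [← Finset.sum_add_distrib] at h1 h2 ⊢
    -- The `x ^ 2` coefficient is `lam * μ p.1 * μ p.2` times the `y ^ 2` coefficient. Removing both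
    -- from the value at `(1, 1)` leaves the `x * y` coefficient.
    have h3 := congrArg₂ (fun a b => a - (lam * μ p.1 * μ p.2 + 1) * b) h1 h2
    simp only [mul_zero, sub_zero] at h3
    rw [← h3, Finset.mul_sum, ← Finset.sum_sub_distrib]
    refine Finset.sum_congr rfl fun l _ => ?_
    have := hE l
    field_simp
    ring

/-- A matrix over `k[X]` that is injective at one point of `k` is injective at every
transcendental point. -/
theorem eq_zero_of_mulVec_map_aeval {k 𝕜 : Type*} [Field k] [Field 𝕜] [Algebra k 𝕜] {m n : Type*}
    [Fintype m] [Fintype n] [DecidableEq m] [DecidableEq n] {Q : Matrix m n (Polynomial k)} {a : k}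
    (ha : ∀ r : n → k, Q.map (Polynomial.eval a) *ᵥ r = 0 → r = 0) {lam : 𝕜}
    (hlam : Transcendental k lam) {r : n → 𝕜}
    (hr : Q.map (Polynomial.aeval lam) *ᵥ r = 0) : r = 0 := by
  obtain ⟨N, hN⟩ := LinearMap.exists_leftInverse_of_injective
    (Matrix.toLin' (Q.map (Polynomial.eval a))) (by
      rw [LinearMap.ker_eq_bot']
      exact fun r hr => ha r (by simpa using hr))
  have hN' : LinearMap.toMatrix' N * Q.map (Polynomial.eval a) = 1 := by
    rw [← LinearMap.toMatrix'_toLin' (Q.map (Polynomial.eval a)), ← LinearMap.toMatrix'_comp, hN,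
      LinearMap.toMatrix'_id]
  -- A left inverse at `a` makes the system square: `det M` is a polynomial with value `1` at `a`,
  -- hence nonzero, hence nonzero at `lam`.
  set M := (LinearMap.toMatrix' N).map Polynomial.C * Q with hM
  have h1 : M.map (Polynomial.evalRingHom a) = 1 := by
    rw [hM, Matrix.map_mul, ← hN', Matrix.map_map]
    congr 1
    ext i j
    simp
  have h2 : M.det ≠ 0 := by
    intro h0
    have h3 := RingHom.map_det (Polynomial.evalRingHom a) M
    rw [h0, map_zero, RingHom.mapMatrix_apply, h1, Matrix.det_one] at h3
    exact zero_ne_one h3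
  have h4 : (M.map (Polynomial.aeval lam)).det ≠ 0 := by
    have h5 := AlgHom.map_det (Polynomial.aeval (R := k) lam) M
    rw [AlgHom.mapMatrix_apply] at h5
    rw [← h5]
    exact fun h0 => h2 ((transcendental_iff.mp hlam) _ h0)
  have h6 : M.map (Polynomial.aeval lam) *ᵥ r = 0 := by
    rw [hM, Matrix.map_mul, ← Matrix.mulVec_mulVec, hr, Matrix.mulVec_zero]
  exact Matrix.eq_zero_of_mulVec_eq_zero h4 h6

theorem linearIndependent_linForm_mul_linElt {𝕜 : Type*} [Field 𝕜] [Algebra ℂ 𝕜] {ι : Type*}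
    [Fintype ι] [DecidableEq ι] {μ : Fin g → ℂ} {φ : ι → Fin g → ℂ} {E : ι → ℂ}
    (hE : ∀ l, E l ≠ 0) {a : ℂ}
    (h : LinearIndependent ℂ fun i : ι × Fin g => relCol μ (φ i.1) (E i.1) (E i.1)⁻¹ a i.2)
    {lam : 𝕜} (hlam : Transcendental ℂ lam) :
    LinearIndependent 𝕜 fun i : ι × Fin g =>
      linForm (fun k => algebraMap ℂ 𝕜 (μ k)) (fun k => algebraMap ℂ 𝕜 (φ i.1 k))
        (algebraMap ℂ 𝕜 (E i.1)) *
      linElt (fun k => algebraMap ℂ 𝕜 (μ k)) (lam / algebraMap ℂ 𝕜 (E i.1)) i.2 := by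
  rw [Fintype.linearIndependent_iff] at h ⊢
  intro r hr
  rw [← funext_iff (g := fun _ => 0)]
  -- The multiplier becomes the variable `X`. The inverse of `E` enters as a constant, which is why
  -- `relCol` takes it as a separate argument.
  refine eq_zero_of_mulVec_map_aeval (a := a) (Q := Matrix.of fun p (i : ι × Fin g) =>
    relCol (fun k => Polynomial.C (μ k)) (fun k => Polynomial.C (φ i.1 k)) (Polynomial.C (E i.1))
      (Polynomial.C (E i.1)⁻¹) Polynomial.X i.2 p) (fun s hs => ?_) hlam ?_
  · funext i
    refine h s ?_ i
    funext p
    have h1 := congrFun hs p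
    simp only [Matrix.mulVec, dotProduct, Matrix.map_apply, Matrix.of_apply] at h1
    rw [Finset.sum_apply, ← h1]
    refine Finset.sum_congr rfl fun i _ => ?_
    rw [← Polynomial.coe_evalRingHom, map_relCol]
    simp [mul_comm]
  · funext p
    have h1 := relCol_relation (μ := fun k => algebraMap ℂ 𝕜 (μ k))
      (φ := fun l k => algebraMap ℂ 𝕜 (φ l k)) (E := fun l => algebraMap ℂ 𝕜 (E l))
      (fun l => (map_ne_zero (algebraMap ℂ 𝕜)).mpr (hE l)) hr p
    simp only [Matrix.mulVec, dotProduct, Matrix.map_apply, Matrix.of_apply]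
    rw [Pi.zero_apply, ← h1]
    refine Finset.sum_congr rfl fun i _ => ?_
    have h2 := map_relCol ((Polynomial.aeval (R := ℂ) lam : Polynomial ℂ →ₐ[ℂ] 𝕜) :
      Polynomial ℂ →+* 𝕜) (fun k => Polynomial.C (μ k)) (fun k => Polynomial.C (φ i.1 k))
      (Polynomial.C (E i.1)) (Polynomial.C (E i.1)⁻¹) Polynomial.X i.2 p
    simp only [RingHom.coe_coe] at h2
    rw [h2]
    simp [mul_comm]

end Relations

/-! ### Independence for small nonzero `ε`. -/

section Perturbation

open Filter Topology

variable {g : ℕ}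

theorem hasDerivAt_pairCol {ψ : ℂ → Fin g → Fin g → ℂ} {ψ' : Fin g → Fin g → ℂ} {a : ℂ}
    (h : ∀ j k, HasDerivAt (fun ε => ψ ε j k) (ψ' j k) a) (i : Fin g) (p : Fin g × Fin g) :
    HasDerivAt (fun ε => pairCol (ψ ε) i p) (pairCol ψ' i p) a := by
  unfold pairCol
  refine HasDerivAt.add ?_ ?_
  · split_ifs
    · exact h _ _
    · exact hasDerivAt_const _ _
  · split_ifs
    · exact h _ _
    · exact hasDerivAt_const _ _

/-- The derivative at `0` of `relCol μ (φ ε) (exp ε) (exp ε)⁻¹ a i` if `φ 0 = 1`. -/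
def relColDeriv (μ φ' : Fin g → ℂ) (a : ℂ) (i : Fin g) :
    (Fin g × Fin g) ⊕ (Fin g × Fin g) → ℂ :=
  Sum.elim (pairCol (fun _ k => φ' k) i)
    (pairCol (fun j k => φ' k * (μ k + a * μ j) + (μ k - a * μ j)) i)

theorem hasDerivAt_relCol (μ : Fin g → ℂ) {φ : ℂ → Fin g → ℂ} {φ' : Fin g → ℂ} (a : ℂ)
    (h : HasDerivAt φ φ' 0) (h0 : φ 0 = 1) (i : Fin g) :
    HasDerivAt (fun ε => relCol μ (φ ε) (Complex.exp ε) (Complex.exp ε)⁻¹ a i)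
      (relColDeriv μ φ' a i) 0 := by
  rw [hasDerivAt_pi] at h ⊢
  rintro (p | p)
  · exact hasDerivAt_pairCol (ψ := fun ε _ k => φ ε k) (fun _ k => h k) i p
  · refine hasDerivAt_pairCol (ψ := fun ε j k => φ ε k *
      (Complex.exp ε * μ k + a * (Complex.exp ε)⁻¹ * μ j))
      (ψ' := fun j k => φ' k * (μ k + a * μ j) + (μ k - a * μ j)) (fun j k => ?_) i p
    have h1 := Complex.hasDerivAt_exp 0
    have h2 := (h1.mul_const (μ k)).add
      (((h1.inv (Complex.exp_ne_zero 0)).const_mul a).mul_const (μ j))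
    have h3 := (h k).mul h2
    convert! h3 using 1
    simp [h0]
    ring

/-- For a relation `s`, the `y ^ 2` rows say that `Y` is antisymmetric. Then the diagonal `x * y`
rows give `2 μ_j (1 - a) q_j = 0`, and the others give `(1 - a) (μ_k - μ_j) Y_jk = 0`. Thus `Y` and
`q` vanish, and `hind` applies for each `j`. -/
theorem linearIndependent_relColDeriv {μ : Fin g → ℂ} (hμ0 : ∀ j, μ j ≠ 0)
    (hμ : Function.Injective μ) {φ' : Fin g → Fin g → ℂ} {a : ℂ} (ha : a ≠ 1)
    (hind : ∀ (s₀ : ℂ) (s : Fin g → ℂ), (∀ k, s₀ + ∑ i, s i * φ' i k = 0) → ∑ i, s i = 0 →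
      s₀ = 0 ∧ s = 0) :
    LinearIndependent ℂ fun i : Option (Fin g) × Fin g =>
      i.1.elim (relCol μ 1 1 1 a i.2) fun l => relColDeriv μ (φ' l) a i.2 := by
  rw [Fintype.linearIndependent_iff]
  intro s hs
  set Y : Fin g → Fin g → ℂ := fun j k => s (none, j) + ∑ l, s (some l, j) * φ' l k with hY
  set q : Fin g → ℂ := fun j => ∑ l, s (some l, j) with hq
  have h1 (j k : Fin g) : Y j k + Y k j = 0 := by
    have h := congrFun hs (Sum.inl (j, k))
    rw [Finset.sum_apply] at h
    have h' := sum_mul_pairCol s (fun l _ k => l.elim 1 fun l => φ' l k) (j, k)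
    simp only [Fintype.sum_option, Option.elim, mul_one] at h'
    rw [Pi.zero_apply] at h
    rw [hY, ← h, ← h']
    refine Finset.sum_congr rfl fun i _ => ?_
    obtain ⟨l | l, i⟩ := i <;> rfl
  have h2 (j k : Fin g) : Y j k * (μ k + a * μ j) + q j * (μ k - a * μ j) +
      (Y k j * (μ j + a * μ k) + q k * (μ j - a * μ k)) = 0 := by
    have h := congrFun hs (Sum.inr (j, k))
    rw [Finset.sum_apply] at h
    have h' := sum_mul_pairCol s (fun l j k => l.elim (1 * (1 * μ k + a * 1 * μ j)) fun l =>
      φ' l k * (μ k + a * μ j) + (μ k - a * μ j)) (j, k)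
    simp only [Fintype.sum_option, Option.elim, mul_add (s _), ← mul_assoc,
      Finset.sum_add_distrib, ← Finset.sum_mul, one_mul, mul_one] at h'
    rw [Pi.zero_apply] at h
    rw [hY, hq, ← h]
    refine Eq.trans ?_ (h'.symm.trans (Finset.sum_congr rfl fun i _ => ?_))
    · ring
    · obtain ⟨l | l, i⟩ := i
      · simp [relCol, pairCol]
      · simp [relColDeriv, pairCol]
  have ha' : 1 - a ≠ 0 := sub_ne_zero.mpr ha.symm
  have hq0 (j : Fin g) : q j = 0 := by
    have h3 : q j * (2 * μ j * (1 - a)) = 0 := by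
      linear_combination h2 j j - (μ j + a * μ j) * h1 j j
    exact (mul_eq_zero.mp h3).resolve_right (mul_ne_zero (mul_ne_zero two_ne_zero (hμ0 j)) ha')
  have hY0 (j k : Fin g) : Y j k = 0 := by
    by_cases hjk : j = k
    · subst hjk
      linear_combination h1 j j / 2
    · have h3 : Y j k * ((1 - a) * (μ k - μ j)) = 0 := by
        linear_combination h2 j k - (μ j + a * μ k) * h1 j k - (μ k - a * μ j) * hq0 j -
          (μ j - a * μ k) * hq0 k
      exact (mul_eq_zero.mp h3).resolve_right
        (mul_ne_zero ha' (sub_ne_zero.mpr fun h => hjk (hμ h.symm)))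
  rintro ⟨l | l, j⟩
  · exact (hind (s (none, j)) (fun l => s (some l, j)) (hY0 j) (hq0 j)).1
  · exact congrFun (hind (s (none, j)) (fun l => s (some l, j)) (hY0 j) (hq0 j)).2 l

/-- At `ε = 0` the columns of every `l` collapse to those of `f`. Their difference quotients,
obtained by invertible column operations for `ε ≠ 0`, converge to an independent family, and
independence of a finite family is an open condition. -/
theorem eventually_linearIndependent_relCol {μ : Fin g → ℂ} (hμ0 : ∀ j, μ j ≠ 0)
    (hμ : Function.Injective μ) {φ : Fin g → ℂ → Fin g → ℂ} {φ' : Fin g → Fin g → ℂ}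
    (hφ : ∀ i, HasDerivAt (φ i) (φ' i) 0) (hφ0 : ∀ i, φ i 0 = 1) {a : ℂ} (ha : a ≠ 1)
    (hind : ∀ (s₀ : ℂ) (s : Fin g → ℂ), (∀ k, s₀ + ∑ i, s i * φ' i k = 0) → ∑ i, s i = 0 →
      s₀ = 0 ∧ s = 0) :
    ∀ᶠ ε in 𝓝[≠] (0 : ℂ), LinearIndependent ℂ fun i : Option (Fin g) × Fin g =>
      relCol μ (i.1.elim 1 fun l => φ l ε) (i.1.elim 1 fun _ => Complex.exp ε)
        (i.1.elim 1 fun _ => Complex.exp ε)⁻¹ a i.2 := by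
  have h1 : Tendsto (fun (ε : ℂ) (i : Option (Fin g) × Fin g) =>
      i.1.elim (relCol μ 1 1 1 a i.2) fun l =>
        slope (fun ε => relCol μ (φ l ε) (Complex.exp ε) (Complex.exp ε)⁻¹ a i.2) 0 ε) (𝓝[≠] 0)
      (𝓝 fun i => i.1.elim (relCol μ 1 1 1 a i.2) fun l => relColDeriv μ (φ' l) a i.2) := by
    rw [tendsto_pi_nhds]
    rintro ⟨l | l, i⟩
    · exact tendsto_const_nhds
    · exact hasDerivAt_iff_tendsto_slope.mp (hasDerivAt_relCol μ a (hφ l) (hφ0 l) i)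
  have h2 := h1.eventually (linearIndependent_relColDeriv hμ0 hμ ha hind).eventually
  filter_upwards [h2, self_mem_nhdsWithin] with ε h3 hε
  rw [Fintype.linearIndependent_iff] at h3 ⊢
  intro r hr
  -- Since column `l` is column `none` plus `ε` times its slope, a relation `r` becomes one with
  -- coefficients `r none + ∑ r l` and `ε * r l`.
  have h4 := h3 (fun i => i.1.elim (r i + ∑ l, r (some l, i.2)) fun _ => ε * r i) (by
    rw [← hr]
    simp only [Fintype.sum_prod_type, Fintype.sum_option, Option.elim, slope, sub_zero, vsub_eq_sub,
      smul_smul, hφ0, Complex.exp_zero, inv_one, add_smul, Finset.sum_add_distrib,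
      Finset.sum_smul, smul_sub]
    rw [Finset.sum_comm (s := Finset.univ) (t := Finset.univ) (f := fun i l =>
      r (some l, i) • relCol μ 1 1 1 a i)]
    simp only [Finset.sum_sub_distrib, mul_right_comm, mul_inv_cancel₀ hε, one_mul]
    abel)
  have h5 (l : Fin g) (i : Fin g) : r (some l, i) = 0 :=
    (mul_eq_zero.mp (h4 (some l, i))).resolve_left hε
  rintro ⟨l | l, i⟩
  · have h6 := h4 (none, i)
    simpa [h5] using h6
  · exact h5 l i

end Perturbation

/-! ### Linear changes of the coordinates `z` and `t`. -/

section LinearSubstitution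

open MvPolynomial

variable {g : ℕ} {𝕜 : Type*} [Field 𝕜]

/-- The substitution of `M z` for `z` and of `N t` for `t`. -/
def linSub (M : Matrix (Fin 2) (Fin 2) 𝕜) (N : Matrix (Fin g) (Fin g) 𝕜) :
    MvPolynomial (Fin 2 ⊕ Fin g) 𝕜 →ₐ[𝕜] MvPolynomial (Fin 2 ⊕ Fin g) 𝕜 :=
  aeval (Sum.elim (fun e => ∑ e', C (M e e') * X (Sum.inl e'))
    (fun k => ∑ j, C (N k j) * X (Sum.inr j)))

/-- The substitution of `p` for `z` and of `N t` for `t`. -/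
def pointSub (p : Fin 2 → 𝕜) (N : Matrix (Fin g) (Fin g) 𝕜) :
    MvPolynomial (Fin 2 ⊕ Fin g) 𝕜 →ₐ[𝕜] MvPolynomial (Fin g) 𝕜 :=
  aeval (Sum.elim (fun e => C (p e)) (fun k => ∑ j, C (N k j) * X j))

theorem linSub_linSub (M M' : Matrix (Fin 2) (Fin 2) 𝕜) (N N' : Matrix (Fin g) (Fin g) 𝕜)
    (H : MvPolynomial (Fin 2 ⊕ Fin g) 𝕜) :
    linSub M N (linSub M' N' H) = linSub (M' * M) (N' * N) H := by
  suffices h : (linSub M N).comp (linSub M' N') = linSub (M' * M) (N' * N) from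
    DFunLike.congr_fun h H
  refine algHom_ext fun i => ?_
  rcases i with i | i
  · simp only [AlgHom.comp_apply, linSub, aeval_X, Sum.elim_inl, map_sum, map_mul, algHom_C,
      algebraMap_eq, Matrix.mul_apply, Finset.sum_mul, Finset.mul_sum]
    rw [Finset.sum_comm]
    simp only [mul_assoc]
  · simp only [AlgHom.comp_apply, linSub, aeval_X, Sum.elim_inr, map_sum, map_mul, algHom_C,
      algebraMap_eq, Matrix.mul_apply, Finset.sum_mul, Finset.mul_sum]
    rw [Finset.sum_comm]
    simp only [mul_assoc]

theorem linSub_one (H : MvPolynomial (Fin 2 ⊕ Fin g) 𝕜) : linSub 1 1 H = H := by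
  suffices h : linSub 1 1 = AlgHom.id 𝕜 (MvPolynomial (Fin 2 ⊕ Fin g) 𝕜) from
    DFunLike.congr_fun h H
  refine algHom_ext fun i => ?_
  rcases i with i | i <;> simp [linSub, Matrix.one_apply, -Fin.sum_univ_two]

theorem linSub_hom (M : Matrix (Fin 2) (Fin 2) 𝕜) (N : Matrix (Fin g) (Fin g) 𝕜)
    {H : MvPolynomial (Fin 2 ⊕ Fin g) 𝕜} {m : ℕ × ℕ} (hH : IsWeightedHomogeneous bideg H m) :
    IsWeightedHomogeneous bideg (linSub M N H) m := by
  rw [H.as_sum, map_sum]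
  refine IsWeightedHomogeneous.sum _ _ _ fun d hd => ?_
  have h1 := hH (mem_support_iff.mp hd)
  rw [← h1, linSub, aeval_monomial, Finsupp.prod_fintype _ _ (fun _ => pow_zero _),
    algebraMap_eq, ← zero_add (Finsupp.weight bideg d), Finsupp.weight_eq_sum]
  refine (isWeightedHomogeneous_C _ _).mul (IsWeightedHomogeneous.prod _ _ _ fun i _ => ?_)
  refine IsWeightedHomogeneous.pow ?_ _
  rcases i with i | i
  · refine IsWeightedHomogeneous.sum _ _ _ fun j _ => ?_
    simpa [bideg] using (isWeightedHomogeneous_C (bideg (g := g)) (M i j)).mul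
      (isWeightedHomogeneous_X 𝕜 (bideg (g := g)) (Sum.inl j))
  · refine IsWeightedHomogeneous.sum _ _ _ fun j _ => ?_
    simpa [bideg] using (isWeightedHomogeneous_C (bideg (g := g)) (N i j)).mul
      (isWeightedHomogeneous_X 𝕜 (bideg (g := g)) (Sum.inr j))

theorem map_linSub {𝕜' : Type*} [Field 𝕜'] (σ : 𝕜 →+* 𝕜') (M : Matrix (Fin 2) (Fin 2) 𝕜)
    (N : Matrix (Fin g) (Fin g) 𝕜) (H : MvPolynomial (Fin 2 ⊕ Fin g) 𝕜) :
    MvPolynomial.map σ (linSub M N H) = linSub (M.map σ) (N.map σ) (MvPolynomial.map σ H) := by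
  induction H using MvPolynomial.induction_on with
  | C a => simp [linSub]
  | add p q hp hq => simp only [map_add, hp, hq]
  | mul_X p i hp =>
    simp only [map_mul, hp, map_X]
    congr 1
    rcases i with i | i <;> simp [linSub]

theorem pointSub_linSub (p : Fin 2 → 𝕜) (N' : Matrix (Fin g) (Fin g) 𝕜)
    (M : Matrix (Fin 2) (Fin 2) 𝕜) (N : Matrix (Fin g) (Fin g) 𝕜)
    (H : MvPolynomial (Fin 2 ⊕ Fin g) 𝕜) :
    pointSub p N' (linSub M N H) = pointSub (M *ᵥ p) (N * N') H := by
  suffices h : (pointSub p N').comp (linSub M N) = pointSub (M *ᵥ p) (N * N') from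
    DFunLike.congr_fun h H
  refine algHom_ext fun i => ?_
  rcases i with i | i
  · simp [pointSub, linSub, Matrix.mulVec, dotProduct]
  · simp only [AlgHom.comp_apply, linSub, pointSub, aeval_X, Sum.elim_inr, map_sum, map_mul,
      algHom_C, algebraMap_eq, Matrix.mul_apply, Finset.sum_mul, Finset.mul_sum]
    rw [Finset.sum_comm]
    simp only [mul_assoc]

theorem evalFst_eq : evalFst (g := g) (𝕜 := 𝕜) = pointSub ![1, 0] 1 := by
  refine algHom_ext fun i => ?_
  rcases i with i | i
  · fin_cases i <;> simp [evalFst, pointSub]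
  · simp [evalFst, pointSub, Matrix.one_apply]

theorem evalSnd_eq (μ : Fin g → 𝕜) : evalSnd μ = pointSub ![0, 1] (Matrix.diagonal μ) := by
  refine algHom_ext fun i => ?_
  rcases i with i | i
  · fin_cases i <;> simp [evalSnd, pointSub]
  · simp only [evalSnd, pointSub, aeval_X, Sum.elim_inr]
    rw [Finset.sum_eq_single i]
    · simp
    · intro j _ hj
      simp [Matrix.diagonal_apply_ne' _ hj]
    · simp

theorem pointSub_smul (a : 𝕜) (p : Fin 2 → 𝕜) (N : Matrix (Fin g) (Fin g) 𝕜)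
    {H : MvPolynomial (Fin 2 ⊕ Fin g) 𝕜} {k l : ℕ} (hH : IsWeightedHomogeneous bideg H (k, l)) :
    pointSub (a • p) N H = C (a ^ k) * pointSub p N H := by
  rw [H.as_sum, map_sum, map_sum, Finset.mul_sum]
  refine Finset.sum_congr rfl fun d hd => ?_
  have h1 := hH (mem_support_iff.mp hd)
  rw [weight_bideg, Prod.mk.injEq] at h1
  rw [pointSub, pointSub, aeval_monomial, aeval_monomial,
    Finsupp.prod_fintype _ _ (fun _ => pow_zero _), Finsupp.prod_fintype _ _ (fun _ => pow_zero _),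
    Fintype.prod_sum_type, Fintype.prod_sum_type, Fin.prod_univ_two, Fin.prod_univ_two, ← h1.1]
  simp only [Sum.elim_inl, Sum.elim_inr, Pi.smul_apply, smul_eq_mul, map_mul C, mul_pow, map_pow,
    pow_add]
  ring

/-- The substitution of `N t` for `t`. -/
def fibreSub (N : Matrix (Fin g) (Fin g) 𝕜) : MvPolynomial (Fin g) 𝕜 →ₐ[𝕜] MvPolynomial (Fin g) 𝕜 :=
  aeval fun k => ∑ j, C (N k j) * X j

theorem fibreSub_pointSub (N N' : Matrix (Fin g) (Fin g) 𝕜) (p : Fin 2 → 𝕜)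
    (H : MvPolynomial (Fin 2 ⊕ Fin g) 𝕜) :
    fibreSub N' (pointSub p N H) = pointSub p (N * N') H := by
  suffices h : (fibreSub N').comp (pointSub p N) = pointSub p (N * N') from
    DFunLike.congr_fun h H
  refine algHom_ext fun i => ?_
  rcases i with i | i
  · simp [pointSub, fibreSub]
  · simp only [AlgHom.comp_apply, fibreSub, pointSub, aeval_X, Sum.elim_inr, map_sum, map_mul,
      algHom_C, algebraMap_eq, Matrix.mul_apply, Finset.sum_mul, Finset.mul_sum]
    rw [Finset.sum_comm]
    simp only [mul_assoc]

/-- The gluing condition in the coordinates in which `[1, 0]` and `[0, 1]` are glued by a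
diagonal matrix. -/
theorem linSub_mem_gluedSub_iff {p₁ p₂ : Fin 2 → 𝕜} {P N : Matrix (Fin g) (Fin g) 𝕜}
    {M : Matrix (Fin 2) (Fin 2) 𝕜} {μ : Fin g → 𝕜} {A : 𝕜} (hA : A ≠ 0)
    (hM₁ : M *ᵥ ![1, 0] = A⁻¹ • p₁) (hM₂ : M *ᵥ ![0, 1] = p₂) (hN : IsUnit N.det)
    (hμ : N * Matrix.diagonal μ = P * N) {lam : 𝕜} {k : ℕ} {H : MvPolynomial (Fin 2 ⊕ Fin g) 𝕜}
    (hH : IsWeightedHomogeneous bideg H (k, k)) :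
    linSub M N H ∈ gluedSub μ lam k ↔
      pointSub p₁ 1 H = C (lam * A ^ k) * pointSub p₂ P H := by
  have h1 : linSub M N H ∈ gluedSub μ lam k ↔
      pointSub p₁ N H = C (lam * A ^ k) * pointSub p₂ (P * N) H := by
    rw [mem_gluedSub, and_iff_right (linSub_hom M N hH), evalFst_eq, evalSnd_eq, pointSub_linSub,
      pointSub_linSub, hM₁, hM₂, hμ, mul_one, pointSub_smul _ _ _ hH]
    -- The normal point `(1, 0)` corresponds to `A⁻¹ • p₁`, so bidegree `(k, k)` produces `A ^ k`.
    have hC : (C (A ^ k) : MvPolynomial (Fin g) 𝕜) ≠ 0 := by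
      rw [Ne, C_eq_zero]
      exact pow_ne_zero _ hA
    rw [← mul_right_inj' hC, ← mul_assoc, ← C_mul, inv_pow, mul_inv_cancel₀ (pow_ne_zero _ hA),
      C_1, one_mul, ← mul_assoc, ← C_mul, mul_comm (A ^ k)]
  rw [h1]
  constructor
  · intro h
    -- Both sides are written in the coordinates `N t`; substituting `N⁻¹ t` for `t` undoes this.
    have h2 := congrArg (fibreSub N⁻¹) h
    rwa [map_mul, algHom_C, algebraMap_eq, fibreSub_pointSub, fibreSub_pointSub, mul_assoc,
      Matrix.mul_nonsing_inv _ hN, mul_one] at h2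
  · intro h
    have h2 := congrArg (fibreSub N) h
    rwa [map_mul, algHom_C, algebraMap_eq, fibreSub_pointSub, fibreSub_pointSub, one_mul] at h2

end LinearSubstitution

namespace Data

open MvPolynomial

variable {g : ℕ} (D : Data g)

/-! ### Normal coordinates attached to the data. -/

section NormalCoordinates

theorem bilin_smul_right (c : Fin 2 → Fin g → ℂ) (z : Fin 2 → ℂ) (a : ℂ) (t : Fin g → ℂ) :
    bilin c z (a • t) = a * bilin c z t := by
  simp only [bilin, Finset.mul_sum, Pi.smul_apply, smul_eq_mul]
  exact Finset.sum_congr rfl fun k _ => by ring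

/-- This is `f(a₁, b₁, v_j)` rewritten by the gluing relation. Its factors being nonzero, the
eigenvalues are invertible and `v_j` can be rescaled so that `f(a₂, b₂, ·)` equals `1` on it. -/
theorem bilin_v (j : Fin g) : D.A * D.ev j * bilin D.f D.p₂ (D.v j) ≠ 0 := by
  have h := D.f_eigen j
  rwa [D.f_glue, D.v_eigen, bilin_smul_right, ← mul_assoc] at h

theorem ev_ne_zero (j : Fin g) : D.ev j ≠ 0 :=
  right_ne_zero_of_mul (left_ne_zero_of_mul (D.bilin_v j))

/-- The eigenvectors of `P`, scaled in such a way that `f(a₂, b₂, ·)` takes the value `1`. -/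
def eigVec (j : Fin g) : Fin g → ℂ := (bilin D.f D.p₂ (D.v j))⁻¹ • D.v j

theorem mulVec_eigVec (j : Fin g) : D.P *ᵥ D.eigVec j = D.ev j • D.eigVec j := by
  rw [eigVec, Matrix.mulVec_smul, D.v_eigen, smul_comm]

/-- The coefficients of a bilinear function in the normal coordinates. -/
def coef (c : Fin 2 → Fin g → ℂ) (j : Fin g) : ℂ := bilin c D.p₂ (D.eigVec j)

theorem coef_f : D.coef D.f = 1 := by
  funext j
  rw [coef, eigVec, bilin_smul_right, inv_mul_cancel₀ (right_ne_zero_of_mul (D.bilin_v j)),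
    Pi.one_apply]

theorem bilin_eigVec {c : Fin 2 → Fin g → ℂ} {κ : ℂ}
    (hg : ∀ t : Fin g → ℂ, bilin c D.p₁ t = κ * bilin c D.p₂ (D.P *ᵥ t)) (j : Fin g) :
    bilin c D.p₁ (D.eigVec j) = κ * (D.ev j * D.coef c j) := by
  rw [hg, D.mulVec_eigVec, bilin_smul_right, coef]

/-- The points of `ℂ²` with normal coordinates `(1, 0)` and `(0, 1)`, as the columns of a matrix. -/
def zMat : Matrix (Fin 2) (Fin 2) ℂ := (Matrix.of ![D.A⁻¹ • D.p₁, D.p₂])ᵀ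

/-- The scaled eigenvectors of `P`, as the columns of a matrix. -/
def tMat : Matrix (Fin g) (Fin g) ℂ := (Matrix.of D.eigVec)ᵀ

theorem isUnit_zMat : IsUnit D.zMat.det := by
  rw [zMat, Matrix.det_transpose, ← Matrix.isUnit_iff_isUnit_det,
    ← Matrix.linearIndependent_rows_iff_isUnit]
  have h := D.indep.units_smul ![(Units.mk0 D.A D.A_ne_zero)⁻¹, 1]
  convert! h using 1
  funext i
  fin_cases i
  · simp [Matrix.row, Units.smul_def]
    rfl
  · simp [Matrix.row]
    rfl

theorem isUnit_tMat : IsUnit D.tMat.det := by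
  rw [tMat, Matrix.det_transpose, ← Matrix.isUnit_iff_isUnit_det,
    ← Matrix.linearIndependent_rows_iff_isUnit]
  refine Module.End.eigenvectors_linearIndependent' (Matrix.toLin' D.P) D.ev D.ev_injective _
    fun j => ?_
  rw [Module.End.hasEigenvector_iff, Module.End.mem_eigenspace_iff]
  refine ⟨D.mulVec_eigVec j, ?_⟩
  exact smul_ne_zero (inv_ne_zero (right_ne_zero_of_mul (D.bilin_v j))) (D.v_ne_zero j)

theorem tMat_mul_diagonal : D.tMat * Matrix.diagonal D.ev = D.P * D.tMat := by
  ext k j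
  rw [Matrix.mul_diagonal]
  have h := congrFun (D.mulVec_eigVec j) k
  rw [Pi.smul_apply, smul_eq_mul, mul_comm] at h
  exact h.symm

/-- The eigenvalues of `P`, as elements of `𝒦`. -/
def evK (j : Fin g) : K := algebraMap ℂ K (D.ev j)

/-- The passage from the original coordinates to the normal ones. -/
def toNormal : Poly g →ₐ[K] Poly g :=
  linSub (D.zMat.map (algebraMap ℂ K)) (D.tMat.map (algebraMap ℂ K))

/-- The passage from the normal coordinates to the original ones. -/
def ofNormal : Poly g →ₐ[K] Poly g :=
  linSub (D.zMat⁻¹.map (algebraMap ℂ K)) (D.tMat⁻¹.map (algebraMap ℂ K))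

theorem toNormal_ofNormal (H : Poly g) : D.toNormal (D.ofNormal H) = H := by
  rw [toNormal, ofNormal, linSub_linSub, ← Matrix.map_mul, ← Matrix.map_mul,
    Matrix.nonsing_inv_mul _ D.isUnit_zMat, Matrix.nonsing_inv_mul _ D.isUnit_tMat,
    Matrix.map_one _ (map_zero _) (map_one _), Matrix.map_one _ (map_zero _) (map_one _),
    linSub_one]

theorem ofNormal_toNormal (H : Poly g) : D.ofNormal (D.toNormal H) = H := by
  rw [toNormal, ofNormal, linSub_linSub, ← Matrix.map_mul, ← Matrix.map_mul,
    Matrix.mul_nonsing_inv _ D.isUnit_zMat, Matrix.mul_nonsing_inv _ D.isUnit_tMat,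
    Matrix.map_one _ (map_zero _) (map_one _), Matrix.map_one _ (map_zero _) (map_one _),
    linSub_one]

theorem toNormal_injective : Function.Injective D.toNormal :=
  Function.LeftInverse.injective D.ofNormal_toNormal

theorem map_ofNormal (σ : K →+* K) (hσ : ∀ a, σ (algebraMap ℂ K a) = algebraMap ℂ K a)
    (H : Poly g) : (D.ofNormal H).map σ = D.ofNormal (H.map σ) := by
  rw [ofNormal, map_linSub, Matrix.map_map, Matrix.map_map]
  have h : σ ∘ algebraMap ℂ K = algebraMap ℂ K := funext hσ
  rw [h]

theorem toNormal_mem_gluedSub_iff {lam : K} {k : ℕ} {H : Poly g}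
    (hH : IsWeightedHomogeneous bideg H (k, k)) :
    D.toNormal H ∈ gluedSub D.evK lam k ↔
      pointSub (fun e => algebraMap ℂ K (D.p₁ e)) 1 H = C (lam * algebraMap ℂ K D.A ^ k) *
        pointSub (fun e => algebraMap ℂ K (D.p₂ e)) (D.P.map (algebraMap ℂ K)) H := by
  refine linSub_mem_gluedSub_iff ((map_ne_zero _).mpr D.A_ne_zero) ?_ ?_ ?_ ?_ hH
  · funext e
    simp [zMat, Matrix.mulVec, dotProduct]
  · funext e
    simp [zMat, Matrix.mulVec, dotProduct]
  · rw [← RingHom.mapMatrix_apply, ← RingHom.map_det]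
    exact D.isUnit_tMat.map _
  · have h := congrArg (fun N => N.map (algebraMap ℂ K)) D.tMat_mul_diagonal
    simp only [Matrix.map_mul] at h
    rw [Matrix.diagonal_map (map_zero _)] at h
    exact h

theorem toNormal_bilinPoly (c : Fin 2 → Fin g → ℂ) :
    D.toNormal (bilinPoly c) = ∑ j,
      (C (algebraMap ℂ K (D.A⁻¹ * bilin c D.p₁ (D.eigVec j))) * X (Sum.inl 0) +
        C (algebraMap ℂ K (D.coef c j)) * X (Sum.inl 1)) * X (Sum.inr j) := by
  have hz (e : Fin 2) : D.toNormal (X (Sum.inl e)) =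
      C (algebraMap ℂ K (D.A⁻¹ * D.p₁ e)) * X (Sum.inl 0) +
        C (algebraMap ℂ K (D.p₂ e)) * X (Sum.inl 1) := by
    rw [toNormal, linSub, aeval_X, Sum.elim_inl, Fin.sum_univ_two]
    rfl
  have ht (k : Fin g) : D.toNormal (X (Sum.inr k)) =
      ∑ j, C (algebraMap ℂ K (D.eigVec j k)) * X (Sum.inr j) := by
    rw [toNormal, linSub, aeval_X, Sum.elim_inr]
    rfl
  have ha (a : ℂ) : D.toNormal (algebraMap ℂ (Poly g) a) = C (algebraMap ℂ K a) :=
    D.toNormal.commutes (algebraMap ℂ K a)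
  simp only [bilinPoly, bilin, map_sum D.toNormal, map_mul D.toNormal, map_add D.toNormal, hz, ht,
    ha, coef, Algebra.algebraMap_self, RingHom.id_apply, Finset.mul_sum]
  rw [Finset.sum_comm]
  refine Finset.sum_congr rfl fun j _ => ?_
  simp only [map_sum, map_add, map_mul, Finset.sum_mul, ← Finset.sum_add_distrib]
  refine Finset.sum_congr rfl fun k _ => ?_
  ring

/-- The scaling of the first point by `A⁻¹` removes the common factor `A`, so that `f` gets
multiplier `1` and `F_i(·, s)` gets `exp s`. -/
theorem toNormal_bilinPoly_of_glue {c : Fin 2 → Fin g → ℂ} {E : ℂ}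
    (hg : ∀ t : Fin g → ℂ, bilin c D.p₁ t = D.A * E * bilin c D.p₂ (D.P *ᵥ t)) :
    D.toNormal (bilinPoly c) =
      linForm D.evK (fun j => algebraMap ℂ K (D.coef c j)) (algebraMap ℂ K E) := by
  rw [toNormal_bilinPoly, linForm]
  refine Finset.sum_congr rfl fun j _ => ?_
  rw [D.bilin_eigVec hg, linElt, evK, mul_assoc, inv_mul_cancel_left₀ D.A_ne_zero]
  simp only [map_mul]
  ring

theorem bilin_gen (c : Fin 2 → Fin g → ℂ) :
    bilin c (zGen (g := g)) tGen = algebraMap (Poly g) (L g) (bilinPoly c) := by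
  simp only [bilin, bilinPoly, zGen, tGen, map_sum, map_mul, map_add,
    ← IsScalarTower.algebraMap_apply]

theorem eq_zero_of_bilin_eigVec {c : Fin 2 → Fin g → ℂ}
    (h₁ : ∀ j, bilin c D.p₁ (D.eigVec j) = 0) (h₂ : ∀ j, D.coef c j = 0) : c = 0 := by
  by_contra hc
  refine bilin_gen_ne_zero hc ?_
  have h : bilinPoly c = 0 := by
    apply D.toNormal_injective
    rw [toNormal_bilinPoly, map_zero]
    simp [h₁, h₂]
  rw [bilin_gen, h, map_zero]

end NormalCoordinates

/-! ### Generic values of `ε`. -/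

section Generic

open Filter Topology

theorem hasDerivAt_bilin {F : ℂ → Fin 2 → Fin g → ℂ} {F' : Fin 2 → Fin g → ℂ} {a : ℂ}
    (h : HasDerivAt F F' a) (z : Fin 2 → ℂ) (t : Fin g → ℂ) :
    HasDerivAt (fun s => bilin (F s) z t) (bilin F' z t) a := by
  have h1 (e : Fin 2) (k : Fin g) : HasDerivAt (fun s => F s e k) (F' e k) a :=
    hasDerivAt_pi.mp (hasDerivAt_pi.mp h e) k
  unfold bilin
  simp only [Algebra.algebraMap_self, RingHom.id_apply]
  exact HasDerivAt.fun_sum fun k _ =>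
    (((h1 0 k).mul_const (z 0)).add ((h1 1 k).mul_const (z 1))).mul_const (t k)

/-- The gluing relation of `F_i` is differentiated at `s = 0`; the summand `1` is the derivative of
`exp s` times the coefficient of `f`, which is `1`. -/
theorem bilin_deriv_eigVec (i j : Fin g) : bilin (deriv (D.F i) 0) D.p₁ (D.eigVec j) =
    D.A * D.ev j * (D.coef (deriv (D.F i) 0) j + 1) := by
  have h := (D.F_analytic i).differentiableAt.hasDerivAt
  have h1 := hasDerivAt_bilin h D.p₁ (D.eigVec j)
  have h2 : HasDerivAt (fun s => D.A * Complex.exp s * (D.ev j * D.coef (D.F i s) j)) _ 0 :=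
    ((Complex.hasDerivAt_exp 0).const_mul D.A).mul
      ((hasDerivAt_bilin h D.p₂ (D.eigVec j)).const_mul (D.ev j))
  have h3 : (fun s => bilin (D.F i s) D.p₁ (D.eigVec j)) =
      fun s => D.A * Complex.exp s * (D.ev j * D.coef (D.F i s) j) :=
    funext fun s => D.bilin_eigVec (D.F_glue i s) j
  rw [h3] at h1
  rw [h1.unique h2, Complex.exp_zero, D.F_zero, D.coef_f, Pi.one_apply, coef]
  ring

theorem bilin_linearCombination (c : Fin (g + 1) → Fin 2 → Fin g → ℂ) (s : Fin (g + 1) → ℂ)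
    (z : Fin 2 → ℂ) (t : Fin g → ℂ) :
    bilin (∑ i, s i • c i) z t = ∑ i, s i * bilin (c i) z t := by
  simp only [bilin, Finset.mul_sum]
  rw [Finset.sum_comm]
  refine Finset.sum_congr rfl fun k _ => ?_
  simp only [Algebra.algebraMap_self, RingHom.id_apply, Finset.sum_apply, Pi.smul_apply,
    smul_eq_mul, Finset.sum_mul, ← Finset.sum_add_distrib]
  refine Finset.sum_congr rfl fun i _ => ?_
  ring

/-- Up to nonzero factors, the combination of `f` and the `∂_s F_i` takes the value `s₀ + ∑ s_i
φ'_ik` at `(p₂, k)` and the same plus `∑ s_i` at `(p₁, k)`. The two conditions therefore make it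
vanish identically. -/
theorem coef_deriv_indep (s₀ : ℂ) (s : Fin g → ℂ)
    (h : ∀ k, s₀ + ∑ i, s i * D.coef (deriv (D.F i) 0) k = 0) (h' : ∑ i, s i = 0) :
    s₀ = 0 ∧ s = 0 := by
  have h1 : ∑ i, (Fin.cons s₀ s : Fin (g + 1) → ℂ) i •
      (Fin.cons D.f (fun i => deriv (D.F i) 0) : Fin (g + 1) → Fin 2 → Fin g → ℂ) i = 0 := by
    have hf (j : Fin g) : bilin D.f D.p₂ (D.eigVec j) = 1 := congrFun D.coef_f j
    refine D.eq_zero_of_bilin_eigVec (fun j => ?_) (fun j => ?_)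
    · rw [bilin_linearCombination, Fin.sum_univ_succ]
      simp only [Fin.cons_zero, Fin.cons_succ, bilin_deriv_eigVec]
      rw [D.bilin_eigVec D.f_glue, coef, hf]
      have h2 : ∑ i, s i * (D.A * D.ev j * (D.coef (deriv (D.F i) 0) j + 1)) =
          D.A * D.ev j * (∑ i, s i * D.coef (deriv (D.F i) 0) j + ∑ i, s i) := by
        rw [← Finset.sum_add_distrib, Finset.mul_sum]
        exact Finset.sum_congr rfl fun i _ => by ring
      rw [h2, h']
      linear_combination D.A * D.ev j * h j
    · rw [coef, bilin_linearCombination, Fin.sum_univ_succ]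
      simp only [Fin.cons_zero, Fin.cons_succ, hf, mul_one]
      exact h j
  have h2 := Fintype.linearIndependent_iff.mp D.F_indep _ h1
  exact ⟨h2 0, funext fun i => h2 i.succ⟩

variable (g) in
/-- The multipliers of `f, f_1, …, f_g`, up to the factor `A`. -/
def optExp (ε : ℂ) (l : Option (Fin g)) : ℂ := l.elim 1 fun _ => Complex.exp ε

theorem optExp_ne_zero (ε : ℂ) (l : Option (Fin g)) : optExp g ε l ≠ 0 := by
  rcases l with l | l
  · exact one_ne_zero
  · exact Complex.exp_ne_zero ε

/-- The coefficients of `f, f_1, …, f_g` in the normal coordinates. -/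
def optCoef (ε : ℂ) (l : Option (Fin g)) : Fin g → ℂ := l.elim 1 fun i => D.coef (D.F i ε)

/-- The products of the `f_l` (where `f_∞ = f`) and of the basis of `M̂_Λ(1)` are linearly
independent if all `c_i h_i` are equal to `ε`. -/
def Generic (ε : ℂ) : Prop :=
  LinearIndependent ℂ fun i : Option (Fin g) × Fin g =>
    relCol D.ev (D.optCoef ε i.1) (optExp g ε i.1) (optExp g ε i.1)⁻¹ 2 i.2

theorem eventually_generic : ∀ᶠ ε in 𝓝[≠] (0 : ℂ), D.Generic ε := by
  simp only [Generic, optCoef, optExp]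
  -- The test value `2` for the multiplier is arbitrary among the numbers different from `1`.
  refine eventually_linearIndependent_relCol D.ev_ne_zero D.ev_injective
    (φ := fun l ε => D.coef (D.F l ε)) (φ' := fun l => D.coef (deriv (D.F l) 0)) (fun i => ?_)
    (fun i => ?_) (by norm_num) D.coef_deriv_indep
  · rw [hasDerivAt_pi]
    exact fun j => hasDerivAt_bilin (D.F_analytic i).differentiableAt.hasDerivAt D.p₂ _
  · rw [D.F_zero, D.coef_f]

theorem eventually_F_ne_zero : ∀ᶠ ε in 𝓝[≠] (0 : ℂ), ∀ i, D.F i ε ≠ 0 := by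
  rw [eventually_all]
  intro i
  refine ((D.F_analytic i).continuousAt.eventually_ne ?_).filter_mono nhdsWithin_le_nhds
  rw [D.F_zero]
  exact D.f_ne_zero

end Generic

/-! ### The product families in the original coordinates. -/

section Families

/-- The step vector `h` for which all `c_i h_i` are equal to `ε`. -/
def stepVec (ε : ℂ) (i : Fin g) : ℂ := ε / D.c i

theorem c_mul_stepVec (ε : ℂ) (i : Fin g) : D.c i * D.stepVec ε i = ε :=
  mul_div_cancel₀ _ (D.c_ne_zero i)

theorem fi_stepVec (ε : ℂ) (i : Fin g) : D.fi (D.stepVec ε) i = D.F i ε := by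
  rw [fi, c_mul_stepVec]

/-- The polynomials `f, f_1, …, f_g`. -/
def optPoly (ε : ℂ) (l : Option (Fin g)) : Poly g := bilinPoly (l.elim D.f fun i => D.F i ε)

theorem toNormal_optPoly (ε : ℂ) (l : Option (Fin g)) :
    D.toNormal (D.optPoly ε l) = linForm D.evK
      (fun j => algebraMap ℂ K (D.optCoef ε l j))
      (algebraMap ℂ K (optExp g ε l)) := by
  rcases l with l | l
  · rw [optPoly, D.toNormal_bilinPoly_of_glue (E := 1) (by simpa using D.f_glue)]
    simp only [Option.elim, D.coef_f, optExp, optCoef]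
  · exact D.toNormal_bilinPoly_of_glue (D.F_glue l ε)

/-- The polynomials that are mapped by `toNormal` to the basis of `gluedSub _ lam 1`. -/
def baseNum (lam : K) (j : Fin g) : Poly g := D.ofNormal (linElt D.evK lam j)

/-- The products of `k` of the polynomials `f, f_1, …, f_g` and of a member of the basis of
the first level. -/
def numFamily (ε : ℂ) (lam : K) (k : ℕ) (x : Exps (Option (Fin g)) k × Fin g) : Poly g :=
  (∏ l, D.optPoly ε l ^ x.1.1 l) *
    D.baseNum (lam / ∏ l, algebraMap ℂ K (optExp g ε l) ^ x.1.1 l) x.2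

theorem toNormal_numFamily (ε : ℂ) (lam : K) (k : ℕ) :
    D.toNormal ∘ D.numFamily ε lam k = prodFamily D.evK (fun l => D.toNormal (D.optPoly ε l))
      (fun l => algebraMap ℂ K (optExp g ε l)) lam k := by
  funext x
  simp only [Function.comp_apply, numFamily, map_mul, map_prod, map_pow, prodFamily, baseNum,
    toNormal_ofNormal]

theorem evK_ne_zero (j : Fin g) : D.evK j ≠ 0 := (map_ne_zero _).mpr (D.ev_ne_zero j)

theorem transcendental_div {lam : K} (h : Transcendental ℂ lam) {a : ℂ} (ha : a ≠ 0) :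
    Transcendental ℂ (lam / algebraMap ℂ K a) := by
  intro h1
  apply h
  have h2 := h1.mul (isAlgebraic_algebraMap (R := ℂ) (A := K) a)
  rwa [div_mul_cancel₀ _ ((map_ne_zero _).mpr ha)] at h2

/-- The transcendental elements of `𝒦` serve as the set of admissible multipliers: they are stable
under division by nonzero constants, and the degree two statement holds for each of them. -/
theorem gluedSub_le_span {ε : ℂ} (hε : D.Generic ε) (k : ℕ) {lam : K}
    (hlam : Transcendental ℂ lam) :
    gluedSub D.evK lam (k + 1) ≤
      Submodule.span K (Set.range (prodFamily D.evK (fun l => D.toNormal (D.optPoly ε l))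
        (fun l => algebraMap ℂ K (optExp g ε l)) lam k)) := by
  refine gluedSub_le_span_prodFamily D.evK_ne_zero _ _ (S := {lam | Transcendental ℂ lam})
    (ρ := algebraMap ℂ K 2) ((map_ne_zero _).mpr two_ne_zero) ?_
    (fun lam h => transcendental_div h two_ne_zero)
    (fun lam h l => transcendental_div h (optExp_ne_zero ε l)) ?_ k lam hlam
  · rw [Ne, map_eq_one_iff _ (algebraMap ℂ K).injective]
    norm_num
  · intro lam h
    simp only [toNormal_optPoly]
    rw [Set.mem_ofPred_eq] at h
    have h1 := linearIndependent_linForm_mul_linElt (μ := D.ev) (E := optExp g ε)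
        (φ := D.optCoef ε) (optExp_ne_zero ε)
      (a := 2) hε (lam := lam) (𝕜 := K) h
    have h2 := gluedSub_two_le_iSup (μ := D.evK) (E := fun l => algebraMap ℂ K (optExp g ε l))
      (φ := fun l j => algebraMap ℂ K (D.optCoef ε l j))
      (by simp) (fun l => (map_ne_zero _).mpr (optExp_ne_zero ε l)) h1
    exact h2

theorem linearIndependent_numFamily {ε : ℂ} (hε : D.Generic ε) (k : ℕ) {lam : K}
    (hlam : Transcendental ℂ lam) : LinearIndependent K (D.numFamily ε lam k) := by
  refine LinearIndependent.of_comp D.toNormal.toLinearMap ?_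
  have h := linearIndependent_prodFamily (by simp) (D.gluedSub_le_span hε k hlam)
  rw [← toNormal_numFamily] at h
  exact h

theorem mem_span_numFamily {ε : ℂ} (hε : D.Generic ε) (k : ℕ) {lam : K}
    (hlam : Transcendental ℂ lam) {H : Poly g} (hH : D.toNormal H ∈ gluedSub D.evK lam (k + 1)) :
    H ∈ Submodule.span K (Set.range (D.numFamily ε lam k)) := by
  have h := D.gluedSub_le_span hε k hlam hH
  rw [← toNormal_numFamily, Set.range_comp] at h
  have h1 := Submodule.map_span D.toNormal.toLinearMap (Set.range (D.numFamily ε lam k))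
  simp only [AlgHom.toLinearMap_apply, AlgHom.coe_toLinearMap] at h1
  rw [← h1] at h
  obtain ⟨G, hG, hGH⟩ := h
  rwa [← D.toNormal_injective hGH]

end Families

/-! ### From the functions `ψ` to glued numerators. -/

section Functions

variable (h : Fin g → ℂ)

theorem shift_const (n : Fin g → ℤ) (a : ℂ) :
    D.shift h n (algebraMap ℂ K a) = algebraMap ℂ K a := translate_const _ _

theorem shift_w (n : Fin g → ℤ) :
    D.shift h n w = algebraMap ℂ K (Complex.exp (∑ i, D.c i * (n i * h i))) * w := translate_w _

theorem isWeightedHomogeneous_map {H : Poly g} {m : ℕ × ℕ} (hH : IsWeightedHomogeneous bideg H m)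
    (σ : K →+* K) : IsWeightedHomogeneous bideg (H.map σ) m := by
  intro d hd
  apply hH
  intro h0
  apply hd
  rw [coeff_map, h0, map_zero]

theorem numer_gen (H : Poly g) (n : Fin g → ℤ) :
    D.numer h H n zGen tGen = algebraMap (Poly g) (L g) (H.map (D.shift h n)) := by
  rw [numer, ← eval₂_map, ← aeval_def]
  have h1 : (aeval (Sum.elim zGen tGen) : Poly g →ₐ[K] L g) = IsScalarTower.toAlgHom K _ _ := by
    refine algHom_ext fun i => ?_
    rcases i with i | i <;> simp [zGen, tGen]
  rw [h1]
  rfl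

theorem numer_point (H : Poly g) (n : Fin g → ℤ) (p : Fin 2 → ℂ) (N : Matrix (Fin g) (Fin g) ℂ) :
    D.numer h H n (const p) (N.map (algebraMap ℂ (L g)) *ᵥ tGen) =
      aeval (tGen (g := g)) (pointSub (fun e => algebraMap ℂ K (p e)) (N.map (algebraMap ℂ K))
        (H.map (D.shift h n))) := by
  rw [numer, ← eval₂_map, ← aeval_def, ← AlgHom.comp_apply]
  suffices h1 : (aeval (Sum.elim (const p) (N.map (algebraMap ℂ (L g)) *ᵥ tGen)) :
      Poly g →ₐ[K] L g) = (aeval (tGen (g := g))).comp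
        (pointSub (fun e => algebraMap ℂ K (p e)) (N.map (algebraMap ℂ K))) from
    DFunLike.congr_fun h1 _
  refine algHom_ext fun i => ?_
  rcases i with i | i
  · rw [aeval_X, Sum.elim_inl, AlgHom.comp_apply, pointSub, aeval_X, Sum.elim_inl, aeval_C,
      ← IsScalarTower.algebraMap_apply]
    rfl
  · rw [aeval_X, Sum.elim_inr, AlgHom.comp_apply, pointSub, aeval_X, Sum.elim_inr, map_sum,
      Matrix.mulVec, dotProduct]
    refine Finset.sum_congr rfl fun j _ => ?_
    rw [map_mul, aeval_C, aeval_X, Matrix.map_apply, Matrix.map_apply,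
      ← IsScalarTower.algebraMap_apply]

theorem aeval_tGen_injective :
    Function.Injective (aeval (tGen (g := g)) : MvPolynomial (Fin g) K →ₐ[K] L g) := by
  have h1 : (aeval (tGen (g := g)) : MvPolynomial (Fin g) K →ₐ[K] L g) =
      (IsScalarTower.toAlgHom K (Poly g) (L g)).comp (rename Sum.inr) := by
    refine algHom_ext fun i => ?_
    simp [tGen]
  rw [h1]
  exact (FaithfulSMul.algebraMap_injective (Poly g) (L g)).comp
    (rename_injective _ Sum.inr_injective)

variable {D h}

theorem prod_ratio (n : Fin g → ℤ) :
    ∏ j, (bilin (D.fi h j) (const D.p₁) tGen / bilin D.f (const (g := g) D.p₁) tGen) ^ n j =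
      algebraMap ℂ (L g) (Complex.exp (∑ i, D.c i * (n i * h i))) *
        ∏ j, (bilin (D.fi h j) (const D.p₂) (D.glue tGen) /
          bilin D.f (const (g := g) D.p₂) (D.glue tGen)) ^ n j := by
  rw [Complex.exp_sum, map_prod, ← Finset.prod_mul_distrib]
  refine Finset.prod_congr rfl fun j _ => ?_
  have h1 : D.c j * (n j * h j) = n j * (D.c j * h j) := by ring
  rw [D.bilin_const_glue (D.fi_glue h j), D.bilin_const_glue D.f_glue, h1, Complex.exp_int_mul,
    map_zpow₀, ← mul_zpow, map_mul, mul_assoc,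
    mul_div_mul_left _ _ ((map_ne_zero _).mpr D.A_ne_zero), mul_div_assoc]

/-- The product of the ratios `(f_j / f) ^ n_j` has multiplier `exp(∑ c_j n_j h_j)`, and translation
by `n h` divides `w⁻¹` by the same number. So the condition at `n` is the translate of the condition
at `0`. -/
theorem psi_glue_iff (hh : D.Admissible h) {k : ℕ} {H : Poly g}
    (hH : IsWeightedHomogeneous bideg H (k, k)) (n : Fin g → ℤ) :
    D.psi h k H n (const D.p₁) tGen =
      algebraMap K (L g) (algebraMap ℂ K D.Λ * w⁻¹) * D.psi h k H n (const D.p₂) (D.glue tGen) ↔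
    D.toNormal (H.map (D.shift h n)) ∈
      gluedSub D.evK (D.shift h n (algebraMap ℂ K D.Λ * w⁻¹)) k := by
  have hA : algebraMap ℂ (L g) D.A ≠ 0 := (map_ne_zero _).mpr D.A_ne_zero
  have hf := (D.bilin_p_ne_zero D.f_ne_zero D.A_ne_zero D.f_glue).2
  have hR : ∏ j, (bilin (D.fi h j) (const D.p₂) (D.glue tGen) /
      bilin D.f (const (g := g) D.p₂) (D.glue tGen)) ^ n j ≠ 0 :=
    Finset.prod_ne_zero_iff.mpr fun j _ => zpow_ne_zero _ (ratio_ne_zero hh j).2.2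
  have h1 := D.numer_point h H n D.p₁ 1
  rw [Matrix.map_one _ (map_zero _) (map_one _), Matrix.map_one _ (map_zero _) (map_one _),
    Matrix.one_mulVec] at h1
  have h2 := D.numer_point h H n D.p₂ D.P
  rw [D.toNormal_mem_gluedSub_iff (isWeightedHomogeneous_map hH _),
    ← aeval_tGen_injective.eq_iff, map_mul (aeval tGen), aeval_C, ← h1, ← h2, psi, psi,
    prod_ratio, D.bilin_const_glue D.f_glue, map_mul (D.shift h n), map_inv₀ (D.shift h n), shift_w,
    shift_const]
  have hE := Complex.exp_ne_zero (∑ i, D.c i * (n i * h i))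
  set E := Complex.exp (∑ i, D.c i * (n i * h i))
  set R := ∏ j, (bilin (D.fi h j) (const D.p₂) (D.glue tGen) /
      bilin D.f (const (g := g) D.p₂) (D.glue tGen)) ^ n j
  have hE' : algebraMap ℂ (L g) E ≠ 0 := (map_ne_zero _).mpr hE
  have hw : algebraMap K (L g) w ≠ 0 := (map_ne_zero _).mpr RatFunc.X_ne_zero
  simp only [map_mul, map_inv₀, map_pow, ← IsScalarTower.algebraMap_apply ℂ K (L g)]
  set a := D.numer h H n (const D.p₁) tGen
  change _ = algebraMap ℂ (L g) D.Λ * (algebraMap K (L g) w)⁻¹ *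
    (D.numer h H n (const D.p₂) (D.glue tGen) / _ ^ k * R) ↔ _ = _ *
      D.numer h H n (const D.p₂) (D.glue tGen)
  set b := D.numer h H n (const D.p₂) (D.glue tGen)
  set F := bilin D.f (const (g := g) D.p₂) (D.glue tGen)
  have hc : algebraMap ℂ (L g) E / (algebraMap ℂ (L g) D.A * F) ^ k * R ≠ 0 :=
    mul_ne_zero (div_ne_zero hE' (pow_ne_zero _ (mul_ne_zero hA hf))) hR
  refine Iff.trans ?_ (mul_left_inj' hc)
  refine Eq.congr (by ring) ?_
  field_simp
  ring

end Functions

/-! ### Values at lattice points, and recovery of a function from its value at `0`. -/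

section Values

theorem algebraMap_bilinPoly_f_ne_zero : algebraMap (Poly g) (L g) (bilinPoly D.f) ≠ 0 := by
  rw [← bilin_gen]
  exact bilin_gen_ne_zero D.f_ne_zero

theorem map_linElt {σ : K →+* K} (hσ : ∀ a, σ (algebraMap ℂ K a) = algebraMap ℂ K a) (lam : K)
    (j : Fin g) : (linElt D.evK lam j).map σ = linElt D.evK (σ lam) j := by
  simp only [linElt, map_mul, map_add, map_C, map_X, evK, hσ]

/-- The coordinate change has constant coefficients, so a translation acts on the multiplier only.
-/
theorem map_baseNum {σ : K →+* K} (hσ : ∀ a, σ (algebraMap ℂ K a) = algebraMap ℂ K a) (lam : K)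
    (j : Fin g) : (D.baseNum lam j).map σ = D.baseNum (σ lam) j := by
  rw [baseNum, D.map_ofNormal σ hσ, D.map_linElt hσ, baseNum]

theorem baseNum_hom (lam : K) (j : Fin g) :
    IsWeightedHomogeneous bideg (D.baseNum lam j) (1, 1) :=
  linSub_hom _ _ (mem_gluedSub.mp (linElt_mem D.evK lam j)).1

/-- The factor `Λ exp(-(c₁ x₁ + ⋯ + c_g x_g))`. -/
def lam₀ : K := algebraMap ℂ K D.Λ * w⁻¹

theorem transcendental_lam₀ : Transcendental ℂ D.lam₀ := by
  intro h
  have h1 := ((isAlgebraic_algebraMap (R := ℂ) (A := K) D.Λ⁻¹).mul h).inv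
  rw [lam₀, map_inv₀, inv_mul_cancel_left₀ ((map_ne_zero _).mpr D.Λ_ne_zero), inv_inv] at h1
  exact RatFunc.transcendental_X h1

variable (h : Fin g → ℂ) in
/-- The elements of the basis of `M̂_Λ`. -/
def basisFun (j : Fin g) (n : Fin g → ℤ) : L g :=
  D.psi h 1 (D.baseNum D.lam₀ j) n zGen tGen

theorem basisFun_mem {h : Fin g → ℂ} (hh : D.Admissible h) (j : Fin g) :
    D.basisFun h j ∈ D.level h 1 := by
  refine ⟨D.baseNum D.lam₀ j, D.baseNum_hom _ _, fun n => ?_, fun n => rfl⟩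
  rw [psi_glue_iff hh (D.baseNum_hom _ _), D.map_baseNum (D.shift_const h n), baseNum,
    toNormal_ofNormal]
  exact linElt_mem _ _ _

theorem shift_stepVec_lam₀ (ε : ℂ) {k : ℕ} (α : Exps (Option (Fin g)) k) :
    D.shift (D.stepVec ε) (fun i => (α.1 (some i) : ℤ)) D.lam₀ =
      D.lam₀ / ∏ l, algebraMap ℂ K (optExp g ε l) ^ α.1 l := by
  have h1 : ∑ i, D.c i * (((α.1 (some i) : ℤ) : ℂ) * D.stepVec ε i) =
      ∑ i, (α.1 (some i) : ℂ) * ε := by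
    refine Finset.sum_congr rfl fun i _ => ?_
    rw [mul_left_comm, c_mul_stepVec, Int.cast_natCast]
  rw [lam₀, map_mul, map_inv₀, shift_w, shift_const, h1, Complex.exp_sum, Fintype.prod_option]
  simp only [optExp, Option.elim, map_one, one_pow, one_mul, Complex.exp_nat_mul, map_prod, map_pow]
  rw [mul_inv, div_eq_mul_inv]
  ring

/-- The exponent of `f` in the index pads the total degree to `k`, which gives all values with `|α|
≤ k` the common denominator `f ^ (k + 1)`. -/
theorem basisFun_stepVec (ε : ℂ) {k : ℕ} (α : Exps (Option (Fin g)) k) (j : Fin g) :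
    D.basisFun (D.stepVec ε) j (fun i => (α.1 (some i) : ℤ)) =
      algebraMap (Poly g) (L g) (D.numFamily ε D.lam₀ k (α, j)) /
        algebraMap (Poly g) (L g) (bilinPoly D.f) ^ (k + 1) := by
  have hf := D.algebraMap_bilinPoly_f_ne_zero
  have hk : k = α.1 none + ∑ i, α.1 (some i) :=
    α.2.symm.trans (Fintype.sum_option _)
  have hp : algebraMap (Poly g) (L g) (bilinPoly D.f) ^ k =
      algebraMap (Poly g) (L g) (bilinPoly D.f) ^ α.1 none *
        algebraMap (Poly g) (L g) (bilinPoly D.f) ^ ∑ i, α.1 (some i) := by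
    rw [← pow_add, ← hk]
  rw [basisFun, psi, numer_gen, D.map_baseNum (D.shift_const _ _), shift_stepVec_lam₀, numFamily]
  simp only [map_mul, map_prod, map_pow, Fintype.prod_option, bilin_gen, fi_stepVec, optPoly,
    Option.elim, zpow_natCast, div_pow, Finset.prod_div_distrib, Finset.prod_pow_eq_pow_sum]
  rw [pow_succ _ k, hp]
  field_simp

/-- The indices are exhausted by `|m| ≤ k`. For fixed `k`, the values are distinct members of the
independent family `numFamily`, divided by `f ^ (k + 1)`. -/
theorem linearIndependent_values {ε : ℂ} (hε : D.Generic ε) :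
    LinearIndependent K fun x : (Fin g → ℕ) × Fin g =>
      D.basisFun (D.stepVec ε) x.2 (fun i => (x.1 i : ℤ)) := by
  set B := fun x : (Fin g → ℕ) × Fin g => D.basisFun (D.stepVec ε) x.2 (fun i => (x.1 i : ℤ))
  let S : ℕ → Set ((Fin g → ℕ) × Fin g) := fun k => {x | ∑ i, x.1 i ≤ k}
  have hS : ⋃ k, S k = Set.univ :=
    Set.eq_univ_of_forall fun x => Set.mem_iUnion.mpr ⟨∑ i, x.1 i, le_refl (∑ i, x.1 i)⟩
  rw [← linearIndepOn_univ_iff, ← hS]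
  refine linearIndepOn_iUnion_of_directed (Monotone.directed_le fun a b hab x hx => ?_) fun k => ?_
  · exact le_trans hx hab
  · let T : Poly g →ₗ[K] L g :=
      (LinearMap.mulRight K (algebraMap (Poly g) (L g) (bilinPoly D.f) ^ (k + 1))⁻¹).comp
        (IsScalarTower.toAlgHom K (Poly g) (L g)).toLinearMap
    have hT : LinearMap.ker T = ⊥ := by
      rw [LinearMap.ker_eq_bot]
      intro x y hxy
      have h1 : algebraMap (Poly g) (L g) x *
          (algebraMap (Poly g) (L g) (bilinPoly D.f) ^ (k + 1))⁻¹ = algebraMap (Poly g) (L g) y *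
          (algebraMap (Poly g) (L g) (bilinPoly D.f) ^ (k + 1))⁻¹ := hxy
      exact FaithfulSMul.algebraMap_injective (Poly g) (L g) (mul_right_cancel₀
        (inv_ne_zero (pow_ne_zero _ D.algebraMap_bilinPoly_f_ne_zero)) h1)
    have h1 := (D.linearIndependent_numFamily hε k D.transcendental_lam₀).map' T hT
    -- The exponent of `f` is the defect `k - |m|`.
    let e : S k → Exps (Option (Fin g)) k × Fin g := fun x =>
      (⟨fun l => l.elim (k - ∑ i, x.1.1 i) x.1.1, by
        rw [Fintype.sum_option]
        exact Nat.sub_add_cancel x.2⟩, x.1.2)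
    have he : Function.Injective e := by
      intro x y hxy
      have h2 := congrArg Prod.snd hxy
      have h3 := fun i => congrFun (congrArg (fun z => z.1.1) hxy) (some i)
      exact Subtype.ext (Prod.ext (funext h3) h2)
    have h2 := h1.comp e he
    rw [LinearIndepOn]
    convert! h2 using 1
    funext x
    exact (D.basisFun_stepVec ε (e x).1 x.1.2).trans (div_eq_mul_inv _ _)

theorem translate_zero (r : K) : translate 0 r = r := by
  induction r using RatFunc.induction_on with
  | f p q hq => simp [map_div₀, translate_algebraMap]

theorem shift_zero (h : Fin g → ℂ) : D.shift h 0 = RingHom.id K := by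
  ext r
  simp [shift, translate_zero]

variable {D} in
theorem psi_zero (h : Fin g → ℂ) (k : ℕ) (H : Poly g) : D.psi h k H 0 zGen tGen =
    algebraMap (Poly g) (L g) H / algebraMap (Poly g) (L g) (bilinPoly D.f) ^ k := by
  rw [psi, numer_gen, shift_zero, MvPolynomial.map_id, bilin_gen]
  simp

variable {D} in
-- Translation by `0` is the identity, so the value at `0` is `H / f ^ k` and recovers `H`, hence
-- all values.
theorem level_ext {h : Fin g → ℂ} {k : ℕ} {ψ φ : (Fin g → ℤ) → L g} (hψ : ψ ∈ D.level h k)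
    (hφ : φ ∈ D.level h k) (h0 : ψ 0 = φ 0) : ψ = φ := by
  obtain ⟨H, -, -, hH⟩ := hψ
  obtain ⟨G, -, -, hG⟩ := hφ
  rw [hH, hG, psi_zero, psi_zero,
    div_left_inj' (pow_ne_zero _ D.algebraMap_bilinPoly_f_ne_zero)] at h0
  have h1 := FaithfulSMul.algebraMap_injective (Poly g) (L g) h0
  funext n
  rw [hH, hG, h1]

theorem apply_zero_mem_span {ε : ℂ} (hε : D.Generic ε) (hh : D.Admissible (D.stepVec ε)) {k : ℕ}
    {ψ : (Fin g → ℤ) → L g} (hψ : ψ ∈ D.level (D.stepVec ε) (k + 1)) :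
    ψ 0 ∈ Submodule.span K (Set.range fun x : (Fin g → ℕ) × Fin g =>
      D.basisFun (D.stepVec ε) x.2 (fun i => (x.1 i : ℤ))) := by
  obtain ⟨H, hH, hG, hψ⟩ := hψ
  have h1 := (psi_glue_iff hh hH 0).mp (hG 0)
  rw [shift_zero, MvPolynomial.map_id] at h1
  have h2 := D.mem_span_numFamily hε k D.transcendental_lam₀ h1
  rw [hψ, psi_zero, div_eq_mul_inv]
  clear hH hG hψ h1
  induction h2 using Submodule.span_induction with
  | mem x hx =>
    obtain ⟨⟨α, j⟩, rfl⟩ := hx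
    rw [← div_eq_mul_inv, ← basisFun_stepVec]
    exact Submodule.subset_span ⟨(fun i => α.1 (some i), j), rfl⟩
  | zero => simp
  | add x y _ _ hx hy =>
    rw [map_add, add_mul]
    exact Submodule.add_mem _ hx hy
  | smul a x _ hx =>
    rw [Algebra.algebraMap_eq_smul_one, smul_assoc, ← Algebra.algebraMap_eq_smul_one, smul_mul_assoc]
    exact Submodule.smul_mem _ _ hx

end Values

/-! ### Normal form of difference operators. -/

section Operators

variable (h : Fin g → ℂ)

/-- Multiplications by discrete functions, as a ring homomorphism. -/
def mulHom : K →+* Module.End ℂ ((Fin g → ℤ) → L g) where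
  toFun := D.mulOp h
  map_one' := by
    refine LinearMap.ext fun ψ => funext fun n => ?_
    simp [mulOp, hat]
  map_mul' a b := by
    refine LinearMap.ext fun ψ => funext fun n => ?_
    simp [mulOp, hat, mul_assoc]
  map_zero' := by
    refine LinearMap.ext fun ψ => funext fun n => ?_
    simp [mulOp, hat]
  map_add' a b := by
    refine LinearMap.ext fun ψ => funext fun n => ?_
    simp [mulOp, hat, add_mul]

variable (g) in
/-- The shift operator `T_1 ^ m_1 ⋯ T_g ^ m_g`. -/
def shiftPow (m : Fin g → ℕ) : Module.End ℂ ((Fin g → ℤ) → L g) where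
  toFun ψ := fun n => ψ (n + fun i => (m i : ℤ))
  map_add' _ _ := rfl
  map_smul' _ _ := rfl

theorem shiftPow_zero : shiftPow g 0 = 1 := by
  refine LinearMap.ext fun ψ => funext fun n => congrArg ψ ?_
  funext i
  simp

theorem shiftPow_add (m l : Fin g → ℕ) : shiftPow g (m + l) = shiftPow g m * shiftPow g l := by
  refine LinearMap.ext fun ψ => funext fun n => congrArg ψ ?_
  funext i
  simp [add_assoc]

theorem shiftPow_single (i : Fin g) : shiftPow g (Pi.single i 1) = shiftOp g i := by
  refine LinearMap.ext fun ψ => funext fun n => congrArg ψ ?_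
  funext j
  by_cases hj : j = i
  · subst hj
    simp
  · simp [Pi.single_eq_of_ne hj]

theorem shiftPow_mul_mulHom (m : Fin g → ℕ) (a : K) : shiftPow g m * D.mulHom h a =
    D.mulHom h (D.shift h (fun i => (m i : ℤ)) a) * shiftPow g m := by
  refine LinearMap.ext fun ψ => funext fun n => ?_
  change algebraMap K (L g) (D.shift h (n + fun i => (m i : ℤ)) a) * _ =
    algebraMap K (L g) (D.shift h n (D.shift h (fun i => (m i : ℤ)) a)) * _
  congr 2
  simp only [shift, translate_translate, ← Finset.sum_add_distrib, Pi.add_apply, Int.cast_add]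
  congr 2
  exact Finset.sum_congr rfl fun i _ => by ring

theorem mulHom_mem (a : K) : D.mulHom h a ∈ D.opRing h :=
  Subring.subset_closure (Or.inl ⟨a, rfl⟩)

theorem shiftPow_mem (m : Fin g → ℕ) : shiftPow g m ∈ D.opRing h := by
  obtain ⟨k, hk⟩ : ∃ k, ∑ j, m j = k := ⟨_, rfl⟩
  induction k generalizing m with
  | zero =>
    have h0 : m = 0 := by
      funext j
      exact (Finset.sum_eq_zero_iff.mp hk) j (Finset.mem_univ j)
    rw [h0, shiftPow_zero]
    exact one_mem _
  | succ k ih =>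
    obtain ⟨j, β, hβ, rfl⟩ := exists_eq_single_add hk
    rw [shiftPow_add, shiftPow_single]
    exact mul_mem (Subring.subset_closure (Or.inr ⟨j, rfl⟩)) (ih β hβ)

/-- The operator `∑ m, r̂_m T ^ m`. -/
def opOf : ((Fin g → ℕ) →₀ K) →+ Module.End ℂ ((Fin g → ℤ) → L g) :=
  Finsupp.liftAddHom fun m =>
    (AddMonoidHom.mulRight (shiftPow g m)).comp (D.mulHom h).toAddMonoidHom

theorem opOf_single (m : Fin g → ℕ) (a : K) :
    D.opOf h (Finsupp.single m a) = D.mulHom h a * shiftPow g m := by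
  rw [opOf, Finsupp.liftAddHom_apply_single]
  rfl

/-- At `n = 0` the coefficient functions become plain scalars of `𝒦`, turning operator relations
into `𝒦`-linear ones between values. -/
theorem opOf_apply_zero (r : (Fin g → ℕ) →₀ K) (ψ : (Fin g → ℤ) → L g) :
    D.opOf h r ψ 0 = r.sum fun m a => a • ψ (fun i => (m i : ℤ)) := by
  induction r using Finsupp.induction_linear with
  | zero => simp
  | add r s hr hs =>
    rw [map_add, LinearMap.add_apply, Pi.add_apply, hr, hs]
    exact (Finsupp.sum_add_index' (h := fun (m : Fin g → ℕ) (a : K) => a • ψ (fun i => (m i : ℤ)))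
      (fun _ => zero_smul _ _) (fun _ _ _ => add_smul _ _ _)).symm
  | single m a =>
    rw [opOf_single, Finsupp.sum_single_index (h := fun (m : Fin g → ℕ) (a : K) => a • ψ (fun i => (m i : ℤ)))
      (zero_smul _ _), Algebra.smul_def]
    change algebraMap K (L g) (D.shift h 0 a) * ψ (0 + _) = _
    rw [shift_zero, zero_add, RingHom.id_apply]

/-- Every element of the ring of difference operators is of the form `∑ m, r̂_m T ^ m`. -/
theorem exists_opOf_eq {T : Module.End ℂ ((Fin g → ℤ) → L g)} (hT : T ∈ D.opRing h) :
    ∃ r, D.opOf h r = T := by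
  -- The operators `r̂ T ^ m` are closed under products, since moving a coefficient to the left of a
  -- shift only translates it.
  have h1 : ∀ x ∈ Submonoid.closure (Set.range (D.mulOp h) ∪ Set.range (shiftOp g)),
      ∃ a m, x = D.mulHom h a * shiftPow g m := by
    intro x hx
    induction hx using Submonoid.closure_induction with
    | mem x hx =>
      rcases hx with ⟨a, rfl⟩ | ⟨i, rfl⟩
      · exact ⟨a, 0, by rw [shiftPow_zero, mul_one]; rfl⟩
      · exact ⟨1, Pi.single i 1, by rw [shiftPow_single, map_one, one_mul]⟩
    | one => exact ⟨1, 0, by rw [shiftPow_zero, map_one, one_mul]⟩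
    | mul x y _ _ hx hy =>
      obtain ⟨a, m, rfl⟩ := hx
      obtain ⟨b, l, rfl⟩ := hy
      refine ⟨a * D.shift h (fun i => (m i : ℤ)) b, m + l, ?_⟩
      rw [shiftPow_add, map_mul, mul_assoc, ← mul_assoc (shiftPow g m), shiftPow_mul_mulHom]
      simp only [mul_assoc]
  have h2 : AddSubgroup.closure (Submonoid.closure
      (Set.range (D.mulOp h) ∪ Set.range (shiftOp g)) : Set (Module.End ℂ ((Fin g → ℤ) → L g))) ≤
      (D.opOf h).range := by
    rw [AddSubgroup.closure_le]
    intro x hx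
    obtain ⟨a, m, rfl⟩ := h1 x hx
    exact ⟨Finsupp.single m a, D.opOf_single h m a⟩
  exact h2 (Subring.mem_closure_iff.mp hT)

end Operators

/-! ### The basis of the module. -/

section Basis

variable {D}

/-- The functions `basisFun`, as elements of the module. -/
def basisElt {ε : ℂ} (hh : D.Admissible (D.stepVec ε)) (j : Fin g) : D.module hh :=
  ⟨D.basisFun (D.stepVec ε) j, Set.mem_iUnion.mpr ⟨1, D.basisFun_mem hh j⟩⟩

/-- A relation over `𝒯_g`, evaluated at `n = 0`, is a `𝒦`-linear relation between the independent
values; all coefficients of the operators vanish. -/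
theorem linearIndependent_basisElt {ε : ℂ} (hε : D.Generic ε)
    (hh : D.Admissible (D.stepVec ε)) :
    LinearIndependent (D.opRing (D.stepVec ε)) (basisElt hh) := by
  rw [Fintype.linearIndependent_iff]
  intro T hT
  choose r hr using fun j => D.exists_opOf_eq (D.stepVec ε) (T j).2
  have h1 : ∑ j, D.opOf (D.stepVec ε) (r j) (D.basisFun (D.stepVec ε) j) 0 = 0 := by
    have h2 := congrFun (congrArg (Submodule.subtype _) hT) 0
    rw [map_sum, Finset.sum_apply, map_zero, Pi.zero_apply] at h2
    rw [← h2]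
    refine Finset.sum_congr rfl fun j _ => ?_
    rw [hr]
    rfl
  have hinj (j : Fin g) : Function.Injective fun m : Fin g → ℕ => (m, j) := fun m l hml =>
    congrArg Prod.fst hml
  have h2 : Finsupp.linearCombination K (fun x : (Fin g → ℕ) × Fin g =>
      D.basisFun (D.stepVec ε) x.2 (fun i => (x.1 i : ℤ)))
      (∑ j, (r j).mapDomain fun m => (m, j)) = 0 := by
    rw [map_sum, ← h1]
    refine Finset.sum_congr rfl fun j _ => ?_
    rw [Finsupp.linearCombination_mapDomain, opOf_apply_zero, Finsupp.linearCombination_apply]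
    rfl
  have h3 := linearIndependent_iff.mp (D.linearIndependent_values hε) _ h2
  intro j
  have h4 : r j = 0 := by
    ext m
    have h5 := DFunLike.congr_fun h3 (m, j)
    rw [Finsupp.finsetSum_apply, Finset.sum_eq_single j, Finsupp.mapDomain_apply (hinj j)] at h5
    · exact h5
    · intro i _ hij
      refine Finsupp.mapDomain_of_notMem_range _ _ ?_
      rintro ⟨l, hl⟩
      exact hij (congrArg Prod.snd hl)
    · simp
  apply Subtype.ext
  rw [← hr, h4, map_zero]
  rfl

/-- Some element of the span has the same value at `0` as `ψ`, and this value determines `ψ`. -/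
theorem span_basisElt {ε : ℂ} (hε : D.Generic ε) (hh : D.Admissible (D.stepVec ε)) :
    ⊤ ≤ Submodule.span (D.opRing (D.stepVec ε)) (Set.range (basisElt hh)) := by
  have key : ∀ x ∈ Submodule.span K (Set.range fun x : (Fin g → ℕ) × Fin g =>
      D.basisFun (D.stepVec ε) x.2 (fun i => (x.1 i : ℤ))),
      ∃ ψ ∈ Submodule.span (D.opRing (D.stepVec ε)) (Set.range (basisElt hh)),
        (ψ : (Fin g → ℤ) → L g) 0 = x := by
    intro x hx
    induction hx using Submodule.span_induction with
    | mem x hx =>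
      obtain ⟨⟨m, j⟩, rfl⟩ := hx
      refine ⟨_, Submodule.smul_mem _
        (⟨shiftPow g m, D.shiftPow_mem _ m⟩ : D.opRing (D.stepVec ε))
        (Submodule.subset_span ⟨j, rfl⟩), ?_⟩
      change D.basisFun (D.stepVec ε) j (0 + _) = _
      rw [zero_add]
    | zero => exact ⟨0, Submodule.zero_mem _, rfl⟩
    | add x y _ _ hx hy =>
      obtain ⟨ψ, hψ, rfl⟩ := hx
      obtain ⟨φ, hφ, rfl⟩ := hy
      exact ⟨ψ + φ, Submodule.add_mem _ hψ hφ, rfl⟩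
    | smul a x _ hx =>
      obtain ⟨ψ, hψ, rfl⟩ := hx
      refine ⟨_, Submodule.smul_mem _
        (⟨D.mulHom _ a, D.mulHom_mem _ a⟩ : D.opRing (D.stepVec ε)) hψ, ?_⟩
      change algebraMap K (L g) (D.shift _ 0 a) * _ = _
      rw [shift_zero, RingHom.id_apply, Algebra.smul_def]
  intro ψ _
  obtain ⟨k, hk⟩ := Set.mem_iUnion.mp ψ.2
  -- Level `k` is raised to `k + 1`, since the spanning result concerns positive degrees.
  obtain ⟨φ, hφ, h0⟩ := key _ (D.apply_zero_mem_span hε hh (level_succ k hk))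
  obtain ⟨l, hl⟩ := Set.mem_iUnion.mp φ.2
  have h1 : φ = ψ := Subtype.ext (level_ext (level_mono (le_max_left l k) hl)
    (level_mono (le_max_right l k) hk) h0)
  rwa [← h1]

end Basis

end Data

end DBA

end

/-! ### Uncountably many step vectors. -/

theorem theorem2 {g : ℕ} (hg : 0 < g) (D : DBA.Data g) :
    ¬ Set.Countable {h : Fin g → ℂ | ∃ hh : D.Admissible h,
      ∃ b : Module.Basis (Fin g) (D.opRing h) (D.module hh),
        ∀ i, (b i : (Fin g → ℤ) → DBA.L g) ∈ D.level h 1} := by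
  intro hc
  have hinj : Function.Injective D.stepVec := fun ε δ h => by
    have h1 := D.c_mul_stepVec ε ⟨0, hg⟩
    rw [h, D.c_mul_stepVec] at h1
    exact h1.symm
  -- If the good step vectors were countable, so would be the corresponding `ε`. The complement of a
  -- countable set is dense in `ℂ`, so it meets the neighbourhood of `0` in which every `ε ≠ 0` is
  -- good.
  have h1 := ((hc.preimage hinj).insert 0).dense_compl ℂ
  have h2 := (D.eventually_generic.and D.eventually_F_ne_zero)
  rw [Filter.Eventually, mem_nhdsWithin_iff_eventually] at h2
  obtain ⟨ε, hε, h3⟩ := h1.inter_nhds_nonempty h2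
  rw [Set.mem_compl_iff, Set.mem_insert_iff, not_or] at hε
  obtain ⟨h4, h5⟩ := h3 hε.1
  have hh : D.Admissible (D.stepVec ε) :=
    ⟨fun i => div_ne_zero hε.1 (D.c_ne_zero i), fun i => by rw [D.fi_stepVec]; exact h5 i⟩
  refine hε.2 ⟨hh, Module.Basis.mk (DBA.Data.linearIndependent_basisElt h4 hh)
    (DBA.Data.span_basisElt h4 hh), fun i => ?_⟩
  rw [Module.Basis.mk_apply]
  exact D.basisFun_mem hh i
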